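/- All graphs are finite, simple and undirected. For a graph $G$, let $\rho(G)$ denote the largest eigenvalue of its adjacency matrix. Let $K_m$ and $I_m$ denote the complete graph and the edgeless graph on $m$ vertices, $G_1+G_2$ the disjoint union of $G_1$ and $G_2$, and $G_1\vee G_2$ their join, obtained from $G_1+G_2$ by adding all edges between $V(G_1)$ and $V(G_2)$. A leaf of a tree $T$ is a vertex of degree $1$ in $T$; the leaf degree of a vertex $v$ of $T$ is the number of leaves of $T$ adjacent to $v$ in $T$; and the leaf degree of $T$ is the maximum leaf degree among all its vertices. Theorem. Let $k\ge 1$ be an integer and let $G$ be a connected graph of order $n$ with minimum degree $\delta$, where $n\ge 3(k+2)\delta+2$. If $$\rho(G)\ \ge\ \rho\bigl(K_\delta\vee(K_{n-k\delta-2\delta}+I_{k\delta+\delta})\bigr),$$ then $G$ has a spanning tree with leaf degree at most $k$ unless $G\cong K_\delta\vee(K_{n-k\delta-2\delta}+I_{k\delta+\delta})$; and in this exceptional case $G$ has no spanning tree with leaf degree at most $k$. -/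

import Mathlib

namespace LeafDegreeSpectral

/-- The join of two graphs on disjoint vertex sets: their disjoint union together with all edges
between the two vertex sets. -/
def join {V W : Type*} (G : SimpleGraph V) (H : SimpleGraph W) : SimpleGraph (V ⊕ W) where
  Adj
    | Sum.inl a, Sum.inl b => G.Adj a b
    | Sum.inr a, Sum.inr b => H.Adj a b
    | Sum.inl _, Sum.inr _ => True
    | Sum.inr _, Sum.inl _ => True
  symm := ⟨by
    rintro (a | a) (b | b) h
    · exact G.adj_symm h
    · trivial
    · trivial
    · exact H.adj_symm h⟩
  loopless := ⟨by
    rintro (a | a) h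
    · exact G.loopless.irrefl a h
    · exact H.loopless.irrefl a h⟩

/-- The graph `K_a ∨ (K_b + I_c)`, where `I_c` is the edgeless graph on `c` vertices. -/
def joinCompleteUnion (a b c : ℕ) : SimpleGraph (Fin a ⊕ (Fin b ⊕ Fin c)) :=
  join (⊤ : SimpleGraph (Fin a))
    (SimpleGraph.sum (⊤ : SimpleGraph (Fin b)) (⊥ : SimpleGraph (Fin c)))

open Classical in
/-- The set of (real) eigenvalues of the adjacency matrix of `G`. -/
noncomputable def adjEigenvalues {V : Type*} [Fintype V] (G : SimpleGraph V) : Set ℝ :=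
  {μ : ℝ | Module.End.HasEigenvalue (Matrix.toLin' (G.adjMatrix ℝ)) μ}

/-- The spectral radius of `G`: the largest eigenvalue of its adjacency matrix. -/
noncomputable def spectralRadius {V : Type*} [Fintype V] (G : SimpleGraph V) : ℝ :=
  sSup (adjEigenvalues G)

/-- The supremum in the definition of the spectral radius is attained. -/
theorem spectralRadius_isGreatest {V : Type*} [Fintype V] [Nonempty V] (G : SimpleGraph V) :
    IsGreatest (adjEigenvalues G) (spectralRadius G) := by
  classical
  have hfin : (adjEigenvalues G).Finite := Module.End.finite_hasEigenvalue _
  have hA : (G.adjMatrix ℝ).IsHermitian := G.isHermitian_adjMatrix ℝ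
  have hne : (adjEigenvalues G).Nonempty := by
    refine ⟨hA.eigenvalues (Classical.arbitrary V), ?_⟩
    have h := hA.eigenvalues_mem_spectrum_real (Classical.arbitrary V)
    rw [← Matrix.spectrum_toLin', ← Module.End.hasEigenvalue_iff_mem_spectrum] at h
    unfold adjEigenvalues
    convert h
  exact ⟨hne.csSup_mem hfin, fun μ hμ => le_csSup hfin.bddAbove hμ⟩

/-- A leaf of `T` is a vertex with exactly one neighbour in `T`. -/
def IsLeaf {V : Type*} (T : SimpleGraph V) (v : V) : Prop :=
  (T.neighborSet v).ncard = 1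

/-- The leaf degree of a vertex `v` of `T`: the number of leaves of `T` adjacent to `v` in `T`. -/
noncomputable def vertexLeafDegree {V : Type*} (T : SimpleGraph V) (v : V) : ℕ :=
  {w : V | T.Adj v w ∧ IsLeaf T w}.ncard

/-- The leaf degree of `T`: the maximum leaf degree among all vertices of `T`. -/
noncomputable def leafDegree {V : Type*} [Fintype V] (T : SimpleGraph V) : ℕ :=
  Finset.univ.sup (vertexLeafDegree T)

/-- `T` is a spanning tree of `G`. -/
def IsSpanningTree {V : Type*} (T G : SimpleGraph V) : Prop :=
  T ≤ G ∧ T.IsTree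

end LeafDegreeSpectral

namespace LeafDegreeSpectral

/-! Two facts are combined. The combinatorial one is Kaneko's criterion: a connected graph on at
least four vertices has a spanning tree of leaf degree at most `k` (with `k ≥ 1`) iff deleting any
nonempty `S` isolates fewer than `(k + 1) * #S` vertices. Necessity is a count in a tree rooted in
`S`.

For sufficiency put `m = k + 1`. Hall's theorem gives a partition into stars with between one and
`m` leaves. Stars with exactly `m` leaves are the danger: one of their leaves must receive a further
tree edge. Choose the partition with fewest full stars and then fewest stuck stars, those from which
no smaller star can be reached through leaves. Local exchanges show that if a stuck star remained,
the centres of suitable stuck stars would be a set isolating `m` times its own size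
(`IsOptimalPacking.stuckCenters_eq_empty`). With no stuck star, the escape edges and star edges form
a forest, which is extended to a spanning tree.

The spectral fact treats a violating `S`, with `s = #S ≥ δ`: here `G` is a subgraph of `K_s ∨ (K_b +
I_{(k+1)s})`. Let `r` be an eigenvalue of the extremal graph, found as a root of its quotient
polynomial. An explicit positive vector is a supersolution at level `r` for the larger graph,
strictly so when `s > δ` (`quotientPoly_pos`). As `r ≤ ρ(G)`, a Perron-Frobenius comparison
(`nbrSum_eq_of_nbrSum_le`) forces equality throughout, so `s = δ` and `G` is the extremal graph. -/

/-- Deleting any nonempty vertex set `S` leaves fewer than `m * #S` isolated vertices. -/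
def IsolatedBound {V : Type*} (G : SimpleGraph V) (m : ℕ) : Prop :=
  ∀ S I : Finset V, S.Nonempty → (∀ v ∈ I, v ∉ S ∧ ∀ w, G.Adj v w → w ∈ S) → I.card < m * S.card

/-! ### Partitions into stars with at most `m` leaves -/

section StarFactor
variable {V : Type*} [Fintype V] [DecidableEq V] {G : SimpleGraph V} {m : ℕ}

/-- Hall's theorem with every vertex available as an image in `m` copies. -/
theorem IsolatedBound.exists_neighbor_map (hG : IsolatedBound G m) (hm : 1 ≤ m)
    (hnbr : ∀ v, ∃ w, G.Adj v w) :
    ∃ f : V → V, (∀ v, G.Adj v (f v)) ∧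
      ∀ c, (Finset.univ.filter fun v => f v = c).card ≤ m := by
  classical
  let t : V → Finset (V × Fin m) := fun v =>
    (Finset.univ.filter fun w => G.Adj v w) ×ˢ Finset.univ
  have hall : ∀ X : Finset V, X.card ≤ (X.biUnion t).card := by
    intro X
    set N : Finset V := Finset.univ.filter fun w => ∃ x ∈ X, G.Adj x w with hN
    have hbi : X.biUnion t = N ×ˢ Finset.univ := by
      ext ⟨w, i⟩
      simp [t, hN]
    rw [hbi, Finset.card_product, Finset.card_univ, Fintype.card_fin]
    -- Vertices of `X` outside the neighbourhood `N` of `X` become isolated once `N \ X` is deleted.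
    have h1 : (X \ N).card ≤ m * (N \ X).card := by
      rcases (X \ N).eq_empty_or_nonempty with h | ⟨x, hx⟩
      · simp [h]
      · have key : ∀ v ∈ X \ N, ∀ w, G.Adj v w → w ∈ N \ X := by
          intro v hv w hvw
          simp only [hN, Finset.mem_sdiff, Finset.mem_filter, Finset.mem_univ, true_and] at hv ⊢
          exact ⟨⟨v, hv.1, hvw⟩, fun hw => hv.2 ⟨w, hw, hvw.symm⟩⟩
        obtain ⟨w, hw⟩ := hnbr x
        refine (hG (N \ X) (X \ N) ⟨w, key x hx w hw⟩ fun v hv => ⟨?_, key v hv⟩).le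
        simp only [Finset.mem_sdiff] at hv ⊢
        tauto
    have h2 := Finset.card_sdiff_add_card_inter X N
    have h3 := Finset.card_sdiff_add_card_inter N X
    rw [Finset.inter_comm] at h3
    rw [← h2, ← h3]
    nlinarith [Nat.zero_le (X ∩ N).card]
  obtain ⟨g, hginj, hg⟩ := (Finset.all_card_le_biUnion_card_iff_exists_injective t).1 hall
  refine ⟨fun v => (g v).1, fun v => ?_, fun c => ?_⟩
  · simpa [t] using hg v
  · have := Finset.card_le_card_of_injOn (s := Finset.univ.filter fun v => (g v).1 = c)
      (t := (Finset.univ : Finset (Fin m))) (fun v => (g v).2) (by simp) (by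
        intro a ha b hb hab
        simp only [Finset.coe_filter, Finset.mem_univ, true_and, Set.mem_ofPred_eq] at ha hb
        exact hginj (Prod.ext (ha.trans hb.symm) hab))
    simpa using this

/-- Take `f` with the most points on 2-cycles. The set `P` of points whose image is off every
2-cycle is closed under preimages, and by maximality its points have full fibres. So `m * #P ≤ #P`,
which empties `P` as `m ≥ 2`. -/
theorem exists_neighbor_map_cube_eq (hm : 2 ≤ m)
    (hf : ∃ f : V → V, (∀ v, G.Adj v (f v)) ∧
      ∀ c, (Finset.univ.filter fun v => f v = c).card ≤ m) :
    ∃ f : V → V, (∀ v, G.Adj v (f v)) ∧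
      (∀ c, (Finset.univ.filter fun v => f v = c).card ≤ m) ∧ ∀ v, f (f (f v)) = f v := by
  classical
  let F : Finset (V → V) := Finset.univ.filter fun f => (∀ v, G.Adj v (f v)) ∧
      ∀ c, (Finset.univ.filter fun v => f v = c).card ≤ m
  obtain ⟨f₀, hf₀⟩ := hf
  obtain ⟨f, hfF, hmax⟩ := F.exists_max_image
    (fun f => (Finset.univ.filter fun v => f (f v) = v).card) ⟨f₀, by simpa [F] using hf₀⟩
  have hfF' : (∀ v, G.Adj v (f v)) ∧
      ∀ c, (Finset.univ.filter fun v => f v = c).card ≤ m := by simpa [F] using hfF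
  obtain ⟨hadj, hfib⟩ := hfF'
  refine ⟨f, hadj, hfib, ?_⟩
  set P : Finset V := Finset.univ.filter fun v => f (f (f v)) ≠ f v with hP
  have hfull : ∀ v ∈ P, m ≤ (Finset.univ.filter fun u => f u = v).card := by
    intro v hv
    by_contra hlt
    push Not at hlt
    have hv : f (f (f v)) ≠ f v := by simpa [hP] using hv
    have hne : v ≠ f v := (hadj v).ne
    -- Sending `f v` back to `v` creates a 2-cycle and destroys none, because `f v` was on no
    -- 2-cycle.
    set g := Function.update f (f v) v with hg
    have hgF : g ∈ F := by
      simp only [F, Finset.mem_filter, Finset.mem_univ, true_and]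
      constructor
      · intro u
        by_cases hu : u = f v
        · subst hu; simpa [hg] using (hadj v).symm
        · simpa [hg, hu] using hadj u
      · intro c
        by_cases hc : c = v
        · subst hc
          have : (Finset.univ.filter fun u => g u = c) ⊆
              insert (f c) (Finset.univ.filter fun u => f u = c) := by
            intro u
            simp only [hg, Function.update_apply, Finset.mem_filter, Finset.mem_insert,
              Finset.mem_univ, true_and]
            split_ifs <;> tauto
          exact (Finset.card_le_card this).trans ((Finset.card_insert_le _ _).trans hlt)
        · refine le_trans (Finset.card_le_card ?_) (hfib c)
          intro u
          simp only [hg, Function.update_apply, Finset.mem_filter, Finset.mem_univ, true_and]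
          split_ifs
          · exact fun h => absurd h.symm hc
          · exact id
    have hlt' : (Finset.univ.filter fun u => f (f u) = u).card <
        (Finset.univ.filter fun u => g (g u) = u).card := by
      refine Finset.card_lt_card ⟨fun u => ?_, fun hsub => ?_⟩
      · simp only [hg, Function.update_apply, Finset.mem_filter, Finset.mem_univ, true_and]
        intro hu
        by_cases h1 : u = f v
        · subst h1; exact absurd hu hv
        · by_cases h2 : f u = f v
          · rw [if_neg h1, if_pos h2]
            rw [h2] at hu
            rw [hu, h2] at hv
            exact absurd rfl hv
          · rw [if_neg h1, if_neg h2, hu]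
      · have : v ∈ Finset.univ.filter fun u => g (g u) = u := by simp [hg, hne]
        have := hsub this
        simp only [Finset.mem_filter, Finset.mem_univ, true_and] at this
        exact hv (by rw [this])
    exact absurd (hmax g hgF) (not_le.2 hlt')
  have hback : ∀ v ∈ P, ∀ u, f u = v → u ∈ P := by
    intro v hv u hu
    simp only [hP, Finset.mem_filter, Finset.mem_univ, true_and] at hv ⊢
    rw [hu]
    intro h
    exact hv (by rw [h])
  have hcount : m * P.card ≤ P.card := by
    calc m * P.card = ∑ v ∈ P, m := by simp [mul_comm]
      _ ≤ ∑ v ∈ P, (Finset.univ.filter fun u => f u = v).card := Finset.sum_le_sum hfull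
      _ = (P.biUnion fun v => Finset.univ.filter fun u => f u = v).card := by
          rw [Finset.card_biUnion]
          intro a _ b _ hab
          rw [Function.onFun, Finset.disjoint_left]
          intro u hua hub
          simp only [Finset.mem_filter, Finset.mem_univ, true_and] at hua hub
          exact hab (hua.symm.trans hub)
      _ ≤ P.card := by
          refine Finset.card_le_card fun u hu => ?_
          simp only [Finset.mem_biUnion, Finset.mem_filter, Finset.mem_univ, true_and] at hu
          obtain ⟨v, hv, huv⟩ := hu
          exact hback v hv u huv
  have hP0 : P.card = 0 := by nlinarith
  intro v
  by_contra h
  have : v ∈ P := by simp [hP, h]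
  rw [Finset.card_eq_zero.1 hP0] at this
  simp at this

/-- The leaves of the star with centre `c`, where `p` sends every vertex to the centre of its
star. -/
def starLeaves (p : V → V) (c : V) : Finset V :=
  Finset.univ.filter fun v => v ≠ c ∧ p v = c

@[simp] theorem mem_starLeaves {p : V → V} {c v : V} :
    v ∈ starLeaves p c ↔ v ≠ c ∧ p v = c := by
  simp [starLeaves]

/-- A partition of the vertices of `G` into stars with between `1` and `m` leaves, given by the
map sending every vertex to the centre of its star. -/
structure IsStarPacking (G : SimpleGraph V) (m : ℕ) (p : V → V) : Prop where
  idem : ∀ v, p (p v) = p v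
  adj : ∀ v, p v ≠ v → G.Adj v (p v)
  nonempty : ∀ c, p c = c → (starLeaves p c).Nonempty
  bound : ∀ c, (starLeaves p c).card ≤ m

/-- Every image lies on a 2-cycle, so each component of `f` is a double star: a 2-cycle with further
vertices hanging at its ends. Cut the middle edge if both ends carry such vertices; otherwise the
component is already a star. -/
theorem exists_isStarPacking_of_cube_eq {f : V → V} (hadj : ∀ v, G.Adj v (f v))
    (hfib : ∀ c, (Finset.univ.filter fun v => f v = c).card ≤ m) (hcube : ∀ v, f (f (f v)) = f v) :
    ∃ p, IsStarPacking G m p := by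
  classical
  let e : V → ℕ := fun v => (Fintype.equivFin V v : ℕ)
  have he : ∀ {u v}, u ≠ v → e u < e v ∨ e v < e u := by
    intro u v huv
    apply lt_or_gt_of_ne
    intro h
    exact huv ((Fintype.equivFin V).injective (Fin.ext h))
  -- A centre carries a hanging vertex, or its partner carries none and the labelling `e` breaks the
  -- tie.
  let ctr : V → Prop := fun v => (∃ u, f u = v ∧ u ≠ f v) ∨
    (f (f v) = v ∧ (∀ u, f u = f v → u = v) ∧ e v < e (f v))
  have hctr : ∀ v, ¬ ctr v → ctr (f v) := by
    intro v hv
    by_cases h1 : f (f v) = v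
    · by_cases h2 : ∃ u, f u = f v ∧ u ≠ v
      · obtain ⟨u, hu, huv⟩ := h2
        exact Or.inl ⟨u, hu, by rwa [h1]⟩
      · push Not at h2
        have h3 : ¬ ∃ u, f u = v ∧ u ≠ f v := fun h => hv (Or.inl h)
        push Not at h3
        refine Or.inr ⟨hcube v, fun u hu => h3 u (by rw [hu, h1]), ?_⟩
        rw [h1]
        exact (he (hadj v).ne').resolve_right fun h => hv (Or.inr ⟨h1, h2, h⟩)
    · exact Or.inl ⟨v, rfl, fun h => h1 h.symm⟩
  let p : V → V := fun v => if ctr v then v else f v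
  have hp1 : ∀ v, ctr v → p v = v := fun v h => if_pos h
  have hp2 : ∀ v, ¬ ctr v → p v = f v := fun v h => if_neg h
  have hpc : ∀ v, ctr (p v) := by
    intro v
    by_cases h : ctr v
    · rwa [hp1 v h]
    · rw [hp2 v h]; exact hctr v h
  refine ⟨p, fun v => hp1 _ (hpc v), fun v hv => ?_, fun c hc => ?_, fun c => ?_⟩
  · have h : ¬ ctr v := fun h => hv (hp1 v h)
    rw [hp2 v h]; exact hadj v
  · have hcc : ctr c := hc ▸ hpc c
    rcases hcc with ⟨u, hu, huc⟩ | ⟨h1, h2, h3⟩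
    · have hffu : f (f u) ≠ u := by rw [hu]; exact huc.symm
      have hn : ¬ ctr u := by
        rintro (⟨t, ht, -⟩ | ⟨h, -⟩)
        · exact hffu (by rw [← ht]; exact hcube t)
        · exact hffu h
      exact ⟨u, by rw [mem_starLeaves, hp2 u hn]; exact ⟨hu ▸ (hadj u).ne, hu⟩⟩
    · have hn : ¬ ctr (f c) := by
        rintro (⟨t, ht, htc⟩ | ⟨-, -, h⟩)
        · exact htc (by rw [h1]; exact h2 t ht)
        · rw [h1] at h; exact absurd h (not_lt.2 h3.le)
      exact ⟨f c, by rw [mem_starLeaves, hp2 _ hn]; exact ⟨(hadj c).ne', h1⟩⟩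
  · refine le_trans (Finset.card_le_card fun v hv => ?_) (hfib c)
    rw [mem_starLeaves] at hv
    have hn : ¬ ctr v := fun h => hv.1 ((hp1 v h).symm.trans hv.2)
    simpa using (hp2 v hn).symm.trans hv.2

theorem IsolatedBound.exists_isStarPacking (hG : IsolatedBound G m) (hm : 2 ≤ m)
    (hnbr : ∀ v, ∃ w, G.Adj v w) : ∃ p, IsStarPacking G m p := by
  obtain ⟨f, h1, h2, h3⟩ :=
    exists_neighbor_map_cube_eq hm (hG.exists_neighbor_map (by lia) hnbr)
  exact exists_isStarPacking_of_cube_eq h1 h2 h3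

end StarFactor

/-! ### Exchanges of star packings -/

theorem forall_of_connected_of_adj {V : Type*} {G : SimpleGraph V} (hG : G.Connected) {P : V → Prop} {a : V} (ha : P a)
    (hP : ∀ u v, P u → G.Adj u v → P v) (b : V) : P b := by
  obtain ⟨w⟩ := hG.preconnected a b
  induction w with
  | nil => exact ha
  | cons h _ ih => exact ih (hP _ _ ha h)

/-- Changing the centre of the star of `c` to its leaf `u`. -/
def recenterMap {V : Type*} [DecidableEq V] (p : V → V) (c u : V) : V → V := fun v => if p v = c then u else p v

theorem recenter_of_eq {V : Type*} [DecidableEq V] {p : V → V} {c u v : V} (h : p v = c) :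
    recenterMap p c u v = u := if_pos h

theorem recenter_of_ne {V : Type*} [DecidableEq V] {p : V → V} {c u v : V} (h : p v ≠ c) :
    recenterMap p c u v = p v := if_neg h

theorem recenter_eq_self_iff {V : Type*} [DecidableEq V] {p : V → V} {c u : V} (hc : p c = c) {a : V} (hau : a ≠ u) :
    recenterMap p c u a = a ↔ p a = a ∧ a ≠ c := by
  by_cases h : p a = c
  · rw [recenter_of_eq h]
    constructor
    · exact fun h' => absurd h'.symm hau
    · rintro ⟨h1, h2⟩
      exact absurd (h1.symm.trans h) h2
  · rw [recenter_of_ne h]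
    constructor
    · refine fun h' => ⟨h', ?_⟩
      rintro rfl
      exact h h'
    · exact fun h' => h'.1

section OptimalPacking
variable {V : Type*} [Fintype V] [DecidableEq V] {G : SimpleGraph V} {m : ℕ} {p : V → V}

/-- The star centres from which a star with fewer than `m` leaves is reached in at most `n` steps,
a step going from a star to another one along an edge leaving one of its leaves. -/
def EscapesIn (G : SimpleGraph V) (m : ℕ) (p : V → V) : ℕ → V → Prop
  | 0, c => p c = c ∧ (starLeaves p c).card < m
  | n + 1, c => EscapesIn G m p n c ∨
      p c = c ∧ ∃ u ∈ starLeaves p c, ∃ x, G.Adj u x ∧ EscapesIn G m p n (p x)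

/-- The centres of the stars with exactly `m` leaves. -/
def fullCenters (m : ℕ) (p : V → V) : Finset V :=
  Finset.univ.filter fun c => p c = c ∧ (starLeaves p c).card = m

open Classical in
/-- The star centres from which no star with fewer than `m` leaves is reached. -/
noncomputable def stuckCenters (G : SimpleGraph V) (m : ℕ) (p : V → V) : Finset V :=
  Finset.univ.filter fun c => p c = c ∧ ∀ n, ¬ EscapesIn G m p n c

theorem mem_stuckCenters {c : V} :
    c ∈ stuckCenters G m p ↔ p c = c ∧ ∀ n, ¬ EscapesIn G m p n c := by
  simp [stuckCenters]

theorem mem_fullCenters {c : V} :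
    c ∈ fullCenters m p ↔ p c = c ∧ (starLeaves p c).card = m := by
  simp [fullCenters]

theorem IsStarPacking.mem_fullCenters_of_stuck (hp : IsStarPacking G m p) {c : V}
    (hc : c ∈ stuckCenters G m p) : c ∈ fullCenters m p := by
  rw [mem_stuckCenters] at hc
  exact mem_fullCenters.2 ⟨hc.1, le_antisymm (hp.bound c) (not_lt.1 fun h => hc.2 0 ⟨hc.1, h⟩)⟩

/-- Taking the adjacent leaves `u` and `x` out of their stars to form a star of their own. -/
theorem IsStarPacking.pair_leaves (hp : IsStarPacking G m p) (hm : 2 ≤ m) {u x : V}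
    (hu : p u ≠ u) (hx : p x ≠ x) (hux : G.Adj u x)
    (hrem : ∀ a, p a = a → ∃ v ∈ starLeaves p a, v ≠ u ∧ v ≠ x) :
    ∃ q, IsStarPacking G m q ∧ fullCenters m q ⊆ (fullCenters m p).erase (p u) := by
  have hne : u ≠ x := hux.ne
  set q : V → V := fun v => if v = u ∨ v = x then x else p v with hq
  have hqu : q u = x := by simp [hq]
  have hqx : q x = x := by simp [hq]
  have hqo : ∀ v, v ≠ u → v ≠ x → q v = p v := fun v h1 h2 => by simp [hq, h1, h2]
  have hpu : ∀ v, p v ≠ u := fun v h => hu (by rw [← h, hp.idem])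
  have hpx : ∀ v, p v ≠ x := fun v h => hx (by rw [← h, hp.idem])
  have hleaf : ∀ a, a ≠ x → starLeaves q a = starLeaves p a \ {u, x} := by
    intro a ha
    ext v
    simp only [mem_starLeaves, Finset.mem_sdiff, Finset.mem_insert, Finset.mem_singleton, hq]
    split_ifs with h
    · simp [h, ha.symm]
    · simp [h]
  have hleafx : starLeaves q x = {u} := by
    ext v
    simp only [mem_starLeaves, Finset.mem_singleton, hq]
    split_ifs with h
    · rcases h with rfl | rfl
      · simp [hne]
      · simp [hne.symm]
    · simp only [hpx, and_false, false_iff]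
      tauto
  refine ⟨q, ⟨fun v => ?_, fun v hv => ?_, fun a ha => ?_, fun a => ?_⟩, fun a ha => ?_⟩
  · by_cases h : v = u ∨ v = x
    · rcases h with rfl | rfl
      · rw [hqu, hqx]
      · rw [hqx, hqx]
    · push Not at h
      rw [hqo v h.1 h.2, hqo _ (hpu v) (hpx v), hp.idem]
  · by_cases h1 : v = u
    · subst h1; rwa [hqu]
    · by_cases h2 : v = x
      · subst h2; exact absurd hqx hv
      · rw [hqo v h1 h2] at hv ⊢; exact hp.adj v hv
  · by_cases h2 : a = x
    · subst h2; rw [hleafx]; simp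
    · have h1 : a ≠ u := by rintro rfl; exact h2 (hqu ▸ ha.symm)
      rw [hqo a h1 h2] at ha
      obtain ⟨v, hv, hvu, hvx⟩ := hrem a ha
      rw [hleaf a h2]
      exact ⟨v, by simp [-mem_starLeaves, hv, hvu, hvx]⟩
  · by_cases h2 : a = x
    · subst h2; rw [hleafx]; simp; lia
    · rw [hleaf a h2]
      exact (Finset.card_le_card Finset.sdiff_subset).trans (hp.bound a)
  · rw [mem_fullCenters] at ha
    obtain ⟨ha, hcard⟩ := ha
    have h2 : a ≠ x := by
      rintro rfl
      rw [hleafx, Finset.card_singleton] at hcard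
      lia
    have h1 : a ≠ u := by rintro rfl; exact h2 (hqu ▸ ha.symm)
    rw [hqo a h1 h2] at ha
    rw [hleaf a h2] at hcard
    have heq : starLeaves p a \ {u, x} = starLeaves p a :=
      Finset.eq_of_subset_of_card_le Finset.sdiff_subset (hcard ▸ hp.bound a)
    rw [Finset.mem_erase, mem_fullCenters]
    refine ⟨?_, ha, by rw [← heq, hcard]⟩
    rintro rfl
    have : u ∈ starLeaves p (p u) := by simp [hu.symm]
    rw [← heq] at this
    simp at this

section Recenter
variable {c u : V}

theorem starLeaves_recenter_of_ne {a : V} (hau : a ≠ u) (hac : a ≠ c) :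
    starLeaves (recenterMap p c u) a = starLeaves p a := by
  ext v
  simp only [mem_starLeaves, recenterMap]
  split_ifs with h
  · simp [h, hau.symm, hac.symm]
  · rfl

theorem IsStarPacking.starLeaves_recenter_self (hp : IsStarPacking G m p)
    (hc : p c = c) (hu : u ∈ starLeaves p c) :
    starLeaves (recenterMap p c u) u = insert c ((starLeaves p c).erase u) := by
  have hu' := mem_starLeaves.1 hu
  have hpu : ∀ v, p v ≠ u := fun v h => hu'.1 (by rw [← hu'.2, ← h, hp.idem])
  ext v
  simp only [mem_starLeaves, recenterMap, Finset.mem_insert, Finset.mem_erase]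
  split_ifs with h
  · simp only [and_true, h]
    by_cases hvc : v = c
    · simp [hvc, hu'.1.symm]
    · simp [hvc]
  · simp only [hpu, and_false, false_iff, h, or_false]
    rintro rfl
    exact h hc

theorem IsStarPacking.card_starLeaves_recenter_self (hp : IsStarPacking G m p)
    (hc : p c = c) (hu : u ∈ starLeaves p c) :
    (starLeaves (recenterMap p c u) u).card = (starLeaves p c).card := by
  rw [hp.starLeaves_recenter_self hc hu, Finset.card_insert_of_notMem (by simp),
    Finset.card_erase_add_one hu]

theorem starLeaves_recenter_old
    (hu : u ∈ starLeaves p c) : starLeaves (recenterMap p c u) c = ∅ := by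
  ext v
  have hu' := mem_starLeaves.1 hu
  simp only [mem_starLeaves, recenterMap, Finset.notMem_empty, iff_false, not_and]
  intro _
  split_ifs with h
  · exact hu'.1
  · exact h

theorem IsStarPacking.recenter (hp : IsStarPacking G m p) (hc : p c = c)
    (hu : u ∈ starLeaves p c) (hadj : ∀ v, p v = c → v ≠ u → G.Adj v u) :
    IsStarPacking G m (recenterMap p c u) := by
  have hu' := mem_starLeaves.1 hu
  have hnl : ∀ a, recenterMap p c u a = a → a ≠ c := by
    rintro a ha rfl
    rw [recenter_of_eq hc] at ha
    exact hu'.1 ha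
  refine ⟨fun v => ?_, fun v hv => ?_, fun a ha => ?_, fun a => ?_⟩
  · by_cases h : p v = c
    · rw [recenter_of_eq h, recenter_of_eq hu'.2]
    · rw [recenter_of_ne h, recenter_of_ne (by rwa [hp.idem]), hp.idem]
  · by_cases h : p v = c
    · rw [recenter_of_eq h] at hv ⊢
      exact hadj v h hv.symm
    · rw [recenter_of_ne h] at hv ⊢
      exact hp.adj v hv
  · by_cases h : a = u
    · subst h; rw [hp.starLeaves_recenter_self hc hu]; simp
    · have hac := hnl a ha
      have : p a ≠ c := by
        intro h'
        rw [recenter_of_eq h'] at ha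
        exact h ha.symm
      rw [recenter_of_ne this] at ha
      rw [starLeaves_recenter_of_ne h hac]
      exact hp.nonempty a ha
  · by_cases h : a = u
    · subst h; rw [hp.card_starLeaves_recenter_self hc hu]; exact hp.bound c
    · by_cases hac : a = c
      · subst hac; rw [starLeaves_recenter_old hu]; simp
      · rw [starLeaves_recenter_of_ne h hac]; exact hp.bound a

/-- Only `u` can become a full centre, and `c` ceases to be one. -/
theorem card_fullCenters_recenter_le (hc : c ∈ fullCenters m p) :
    (fullCenters m (recenterMap p c u)).card ≤ (fullCenters m p).card := by
  have hc' := mem_fullCenters.1 hc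
  have : fullCenters m (recenterMap p c u) ⊆
      insert u ((fullCenters m p).erase c) := by
    intro a ha
    rw [mem_fullCenters] at ha
    by_cases h : a = u
    · simp [h]
    · rw [recenter_eq_self_iff hc'.1 h] at ha
      rw [starLeaves_recenter_of_ne h ha.1.2] at ha
      rw [Finset.mem_insert, Finset.mem_erase, mem_fullCenters]
      exact Or.inr ⟨ha.1.2, ha.1.1, ha.2⟩
  refine (Finset.card_le_card this).trans ((Finset.card_insert_le _ _).trans ?_)
  rw [Finset.card_erase_add_one hc]

/-- An escape route never visits the stuck star of `c`, the only star that changes. -/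
theorem IsStarPacking.escapesIn_recenter (hp : IsStarPacking G m p)
    (hc : c ∈ stuckCenters G m p) (hu : u ∈ starLeaves p c) :
    ∀ n d, d ≠ u → EscapesIn G m p n d →
      EscapesIn G m (recenterMap p c u) n d := by
  rw [mem_stuckCenters] at hc
  have hu' := mem_starLeaves.1 hu
  intro n
  induction n with
  | zero =>
    intro d hdu hd
    have hdc : d ≠ c := by rintro rfl; exact hc.2 0 hd
    refine ⟨(recenter_eq_self_iff hc.1 hdu).2 ⟨hd.1, hdc⟩, ?_⟩
    rw [starLeaves_recenter_of_ne hdu hdc]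
    exact hd.2
  | succ n ih =>
    intro d hdu hd
    have hdc : d ≠ c := by rintro rfl; exact hc.2 (n + 1) hd
    rcases hd with hd | ⟨hd, w, hw, x, hwx, hx⟩
    · exact Or.inl (ih d hdu hd)
    · have hxc : p x ≠ c := by intro h; rw [h] at hx; exact hc.2 n hx
      refine Or.inr ⟨(recenter_eq_self_iff hc.1 hdu).2 ⟨hd, hdc⟩, w, ?_, x, hwx, ?_⟩
      · rwa [starLeaves_recenter_of_ne hdu hdc]
      · rw [recenter_of_ne hxc]
        refine ih _ ?_ hx
        intro h
        exact hu'.1 (by rw [← hu'.2, ← h, hp.idem])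

theorem IsStarPacking.stuckCenters_recenter_subset (hp : IsStarPacking G m p)
    (hc : c ∈ stuckCenters G m p) (hu : u ∈ starLeaves p c) :
    stuckCenters G m (recenterMap p c u) ⊆
      insert u ((stuckCenters G m p).erase c) := by
  intro a ha
  rw [mem_stuckCenters] at ha
  by_cases h : a = u
  · simp [h]
  · have hc' := (mem_stuckCenters.1 hc).1
    rw [recenter_eq_self_iff hc' h] at ha
    rw [Finset.mem_insert, Finset.mem_erase, mem_stuckCenters]
    exact Or.inr ⟨ha.1.2, ha.1.1, fun n hn => ha.2 n (hp.escapesIn_recenter hc hu n a h hn)⟩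

end Recenter

/-! ### Stuck stars of an optimal packing -/

/-- The quantity minimised by an optimal packing: lexicographically, the number of stars with `m`
leaves and the number of stuck stars. -/
noncomputable def packingCost (G : SimpleGraph V) (m : ℕ) (p : V → V) : ℕ :=
  (fullCenters m p).card * (Fintype.card V + 1) + (stuckCenters G m p).card

/-- A star packing of minimal cost. -/
structure IsOptimalPacking (G : SimpleGraph V) (m : ℕ) (p : V → V) : Prop
    extends IsStarPacking G m p where
  optimal : ∀ q, IsStarPacking G m q → packingCost G m p ≤ packingCost G m q

theorem exists_isOptimalPacking (h : ∃ p, IsStarPacking G m p) : ∃ p, IsOptimalPacking G m p := by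
  classical
  obtain ⟨p₀, hp₀⟩ := h
  obtain ⟨p, hp, hmin⟩ := (Finset.univ.filter fun p => IsStarPacking G m p).exists_min_image
    (packingCost G m) ⟨p₀, by simpa using hp₀⟩
  exact ⟨p, ⟨by simpa using hp, fun q hq => hmin q (by simpa using hq)⟩⟩

/-- There are at most `#V` stuck centres, so the weight `#V + 1` makes the number of full stars
decisive. -/
theorem IsOptimalPacking.not_card_fullCenters_lt (hp : IsOptimalPacking G m p) {q : V → V}
    (hq : IsStarPacking G m q) : ¬ (fullCenters m q).card < (fullCenters m p).card := by
  intro h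
  have h1 := hp.optimal q hq
  have h2 : (stuckCenters G m q).card ≤ Fintype.card V := Finset.card_le_univ _
  unfold packingCost at h1
  nlinarith

/-- An edge leaving the star of a stuck centre from a leaf ends at a stuck centre. -/
theorem IsOptimalPacking.leaf_adj (hp : IsOptimalPacking G m p) (hm : 2 ≤ m) {c u x : V}
    (hc : c ∈ stuckCenters G m p) (hu : u ∈ starLeaves p c) (hux : G.Adj u x) (hx : p x ≠ c) :
    x ∈ stuckCenters G m p := by
  have hc' := mem_stuckCenters.1 hc
  have hu' := mem_starLeaves.1 hu
  have hpx : p x ∈ stuckCenters G m p :=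
    mem_stuckCenters.2 ⟨hp.idem x, fun n hn => hc'.2 (n + 1) (Or.inr ⟨hc'.1, u, hu, x, hux, hn⟩)⟩
  by_cases hxx : p x = x
  · rwa [hxx] at hpx
  -- If `x` were a leaf, pairing it with `u` would shrink two full stars and create only a one-leaf
  -- star.
  exfalso
  have hfc := hp.mem_fullCenters_of_stuck hc
  have hfx := mem_fullCenters.1 (hp.mem_fullCenters_of_stuck hpx)
  have hfc' := mem_fullCenters.1 hfc
  obtain ⟨q, hq, hsub⟩ := hp.pair_leaves (u := u) (x := x) hm
    (by rw [hu'.2]; exact hu'.1.symm) hxx hux (by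
      intro a ha
      by_cases hac : a = c
      · subst hac
        obtain ⟨v, hv, hvu⟩ := Finset.exists_mem_ne (by lia : 1 < (starLeaves p a).card) u
        refine ⟨v, hv, hvu, ?_⟩
        rintro rfl
        exact hx (mem_starLeaves.1 hv).2
      · by_cases hax : a = p x
        · subst hax
          obtain ⟨v, hv, hvx⟩ := Finset.exists_mem_ne (by lia : 1 < (starLeaves p (p x)).card) x
          refine ⟨v, hv, ?_, hvx⟩
          rintro rfl
          exact hac ((mem_starLeaves.1 hv).2.symm.trans hu'.2)
        · obtain ⟨v, hv⟩ := hp.nonempty a ha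
          refine ⟨v, hv, ?_, ?_⟩
          · rintro rfl
            exact hac ((mem_starLeaves.1 hv).2.symm.trans hu'.2)
          · rintro rfl
            exact hax (mem_starLeaves.1 hv).2.symm)
  rw [hu'.2] at hsub
  refine hp.not_card_fullCenters_lt hq ((Finset.card_le_card hsub).trans_lt ?_)
  exact Finset.card_erase_lt_of_mem hfc

/-- If `m ≥ 3`, splitting off the edge `uw` leaves the full star of `c` a leaf and lowers the number
of full stars. -/
theorem IsOptimalPacking.eq_two_of_leaves_adj (hp : IsOptimalPacking G m p) (hm : 2 ≤ m)
    {c u w : V} (hc : c ∈ stuckCenters G m p) (hu : u ∈ starLeaves p c)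
    (hw : w ∈ starLeaves p c) (huw : G.Adj u w) : m = 2 := by
  have hu' := mem_starLeaves.1 hu
  have hw' := mem_starLeaves.1 hw
  have hfc := hp.mem_fullCenters_of_stuck hc
  have hfc' := mem_fullCenters.1 hfc
  by_contra hm2
  obtain ⟨q, hq, hsub⟩ := hp.pair_leaves (u := u) (x := w) hm
    (by rw [hu'.2]; exact hu'.1.symm) (by rw [hw'.2]; exact hw'.1.symm) huw (by
      intro a ha
      by_cases hac : a = c
      · subst hac
        have : 0 < ((starLeaves p a) \ {u, w}).card := by
          have h1 := Finset.le_card_sdiff {u, w} (starLeaves p a)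
          have h2 := Finset.card_le_two (a := u) (b := w)
          lia
        obtain ⟨v, hv⟩ := Finset.card_pos.1 this
        simp only [Finset.mem_sdiff, Finset.mem_insert, Finset.mem_singleton, not_or] at hv
        exact ⟨v, hv.1, hv.2.1, hv.2.2⟩
      · obtain ⟨v, hv⟩ := hp.nonempty a ha
        refine ⟨v, hv, ?_, ?_⟩
        · rintro rfl
          exact hac ((mem_starLeaves.1 hv).2.symm.trans hu'.2)
        · rintro rfl
          exact hac ((mem_starLeaves.1 hv).2.symm.trans hw'.2))
  rw [hu'.2] at hsub
  refine hp.not_card_fullCenters_lt hq ((Finset.card_le_card hsub).trans_lt ?_)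
  exact Finset.card_erase_lt_of_mem hfc

/-- Here `m = 2` and the star spans a triangle, so any of its vertices can be the centre. The cost
cannot rise, hence by optimality stays equal, which turns the inclusion of stuck sets into an
equality. -/
theorem IsOptimalPacking.recenter (hp : IsOptimalPacking G m p) (hm : 2 ≤ m)
    {c u w : V} (hc : c ∈ stuckCenters G m p) (hu : u ∈ starLeaves p c)
    (hw : w ∈ starLeaves p c) (huw : G.Adj u w) :
    IsOptimalPacking G m (recenterMap p c u) ∧
      stuckCenters G m (recenterMap p c u) =
        insert u ((stuckCenters G m p).erase c) := by
  have hu' := mem_starLeaves.1 hu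
  have hw' := mem_starLeaves.1 hw
  have hcc := (mem_stuckCenters.1 hc).1
  have hfc := hp.mem_fullCenters_of_stuck hc
  have hfc' := mem_fullCenters.1 hfc
  have hm2 := hp.eq_two_of_leaves_adj hm hc hu hw huw
  have hq : IsStarPacking G m (recenterMap p c u) := by
    refine hp.toIsStarPacking.recenter hcc hu fun v hv hvu => ?_
    by_cases hvc : v = c
    · subst hvc
      have := hp.adj u (by rw [hu'.2]; exact hu'.1.symm)
      rw [hu'.2] at this
      exact this.symm
    · have h1 : ({u, w} : Finset V) = starLeaves p c := by
        refine Finset.eq_of_subset_of_card_le ?_ ?_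
        · intro y hy
          rcases Finset.mem_insert.1 hy with rfl | hy
          · exact hu
          · rw [Finset.mem_singleton.1 hy]; exact hw
        · rw [Finset.card_pair huw.ne, hfc'.2, hm2]
      have h2 : v ∈ starLeaves p c := mem_starLeaves.2 ⟨hvc, hv⟩
      rw [← h1] at h2
      simp only [Finset.mem_insert, Finset.mem_singleton, hvu, false_or] at h2
      rw [h2]; exact huw.symm
  have h1 := hp.optimal _ hq
  have h2 := card_fullCenters_recenter_le (u := u) hfc
  have h3 := hp.stuckCenters_recenter_subset hc hu
  have h4 : (insert u ((stuckCenters G m p).erase c)).card = (stuckCenters G m p).card := by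
    rw [Finset.card_insert_of_notMem, Finset.card_erase_add_one hc]
    intro h
    have := (mem_stuckCenters.1 (Finset.mem_of_mem_erase h)).1
    rw [hu'.2] at this
    exact hu'.1 this.symm
  have h5 := Finset.card_le_card h3
  have h6 : (stuckCenters G m p).card ≤
      (stuckCenters G m (recenterMap p c u)).card := by
    unfold packingCost at h1
    nlinarith
  refine ⟨⟨hq, fun q' hq' => le_trans ?_ (hp.optimal q' hq')⟩, ?_⟩
  · unfold packingCost
    exact Nat.add_le_add (Nat.mul_le_mul_right _ h2) (h5.trans h4.le)
  · exact Finset.eq_of_subset_of_card_le h3 (h4.le.trans h6)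

/-- An edge leaving the star of a stuck centre from its centre ends at a stuck centre if the star
spans an edge between two leaves. -/
theorem IsOptimalPacking.center_adj (hp : IsOptimalPacking G m p) (hm : 2 ≤ m)
    {c u w x : V} (hc : c ∈ stuckCenters G m p) (hu : u ∈ starLeaves p c)
    (hw : w ∈ starLeaves p c) (huw : G.Adj u w) (hcx : G.Adj c x) (hx : p x ≠ c) :
    x ∈ stuckCenters G m p := by
  have hu' := mem_starLeaves.1 hu
  have hcc := (mem_stuckCenters.1 hc).1
  obtain ⟨hq, hB⟩ := hp.recenter hm hc hu hw huw
  have hxu : p x ≠ u := fun h => hu'.1 (by rw [← hu'.2, ← h, hp.idem])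
  have := hq.leaf_adj hm (c := u) (u := c) (x := x) (by rw [hB]; simp)
    (by rw [hp.starLeaves_recenter_self hcc hu]; simp) hcx (by rwa [recenter_of_ne hx])
  rw [hB, Finset.mem_insert] at this
  rcases this with rfl | h
  · exact absurd hu'.2 hx
  · exact Finset.mem_of_mem_erase h

/-- Recentring the first triangle makes `c` a leaf, while `center_adj` at `c'` would make it a stuck
centre. -/
theorem IsOptimalPacking.not_adj_of_triangles (hp : IsOptimalPacking G m p) (hm : 2 ≤ m)
    {c u w c' u' w' : V} (hc : c ∈ stuckCenters G m p) (hu : u ∈ starLeaves p c)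
    (hw : w ∈ starLeaves p c) (huw : G.Adj u w) (hc' : c' ∈ stuckCenters G m p)
    (hu' : u' ∈ starLeaves p c') (hw' : w' ∈ starLeaves p c') (huw' : G.Adj u' w') :
    ¬ G.Adj c c' := by
  intro hadj
  have hul := mem_starLeaves.1 hu
  have hcc := (mem_stuckCenters.1 hc).1
  have hcc' := (mem_stuckCenters.1 hc').1
  obtain ⟨hq, hB⟩ := hp.recenter hm hc hu hw huw
  have hne : c' ≠ u := by
    rintro rfl
    exact hul.1 (hcc'.symm.trans hul.2)
  have hleaves := starLeaves_recenter_of_ne (p := p) hne hadj.ne'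
  have := hq.center_adj hm (c := c') (u := u') (w := w') (x := c)
    (by rw [hB]; simp [hc', hadj.ne']) (by rwa [hleaves]) (by rwa [hleaves]) huw' hadj.symm
    (by rw [recenter_of_eq hcc]; exact hne.symm)
  have := (mem_stuckCenters.1 this).1
  rw [recenter_of_eq hcc] at this
  exact hul.1 this

theorem IsOptimalPacking.stuckCenters_eq_empty (hp : IsOptimalPacking G m p) (hm : 2 ≤ m)
    (hG : G.Connected) (hcard : 4 ≤ Fintype.card V) (hiso : IsolatedBound G m) :
    stuckCenters G m p = ∅ := by
  classical
  let Tri : V → Prop := fun c => ∃ u ∈ starLeaves p c, ∃ w ∈ starLeaves p c, G.Adj u w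
  have hleafTri : ∀ c u x, c ∈ stuckCenters G m p → u ∈ starLeaves p c → G.Adj u x → p x ≠ c →
      x ∈ stuckCenters G m p ∧ ¬ Tri x := by
    intro c u x hc hu hux hx
    have hxB := hp.leaf_adj hm hc hu hux hx
    refine ⟨hxB, ?_⟩
    rintro ⟨u', hu', w', hw', huw'⟩
    have hul := mem_starLeaves.1 hu
    have hxx := (mem_stuckCenters.1 hxB).1
    have := hp.center_adj hm hxB hu' hw' huw' hux.symm (by
      rw [hul.2]; rintro rfl; exact hx hxx)
    have := (mem_stuckCenters.1 this).1
    exact hul.1 (this.symm.trans hul.2)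
  -- If `S` is empty, a stuck star is a triangle with no outgoing edge, so connectedness leaves only
  -- three vertices. Otherwise the `m * #S` leaves of the stars centred in `S` are isolated by
  -- deleting `S`.
  set S := (stuckCenters G m p).filter fun c => ¬ Tri c with hS
  rcases S.eq_empty_or_nonempty with hS0 | hS0
  · by_contra hne
    obtain ⟨c, hc⟩ := Finset.nonempty_iff_ne_empty.2 hne
    have htri : ∀ x ∈ stuckCenters G m p, Tri x := by
      intro x hx
      by_contra h
      have : x ∈ S := by simp [hS, hx, h]
      simp [hS0] at this
    have hcc := (mem_stuckCenters.1 hc).1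
    obtain ⟨u, hu, w, hw, huw⟩ := htri c hc
    have hall : ∀ v, p v = c := by
      refine forall_of_connected_of_adj hG (P := fun v => p v = c) hcc fun v x hv hvx => ?_
      by_contra hx
      by_cases hvc : v = c
      · subst hvc
        have hxB := hp.center_adj hm hc hu hw huw hvx hx
        obtain ⟨u', hu', w', hw', huw'⟩ := htri x hxB
        exact hp.not_adj_of_triangles hm hc hu hw huw hxB hu' hw' huw' hvx
      · obtain ⟨h1, h2⟩ := hleafTri c v x hc (mem_starLeaves.2 ⟨hvc, hv⟩) hvx hx
        exact h2 (htri x h1)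
    have hm2 := hp.eq_two_of_leaves_adj hm hc hu hw huw
    have hle : Fintype.card V ≤ 3 := by
      have : (Finset.univ : Finset V) ⊆ insert c (starLeaves p c) := by
        intro v _
        by_cases hvc : v = c
        · simp [hvc]
        · simp [hvc, hall v]
      have h1 := (Finset.card_le_card this).trans (Finset.card_insert_le _ _)
      have h2 := hp.bound c
      rw [Finset.card_univ] at h1
      lia
    lia
  · exfalso
    have hSB : ∀ c ∈ S, c ∈ stuckCenters G m p ∧ ¬ Tri c := by
      intro c hc
      simpa [hS] using hc
    have hI := hiso S (S.biUnion (starLeaves p)) hS0 (by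
      intro v hv
      rw [Finset.mem_biUnion] at hv
      obtain ⟨c, hc, hv⟩ := hv
      have hv' := mem_starLeaves.1 hv
      obtain ⟨hcB, hcT⟩ := hSB c hc
      refine ⟨fun hvS => ?_, fun w hvw => ?_⟩
      · have := (mem_stuckCenters.1 (hSB v hvS).1).1
        exact hv'.1 (this.symm.trans hv'.2)
      · by_cases hw : p w = c
        · by_cases hwc : w = c
          · rwa [hwc]
          · exact absurd ⟨v, hv, w, mem_starLeaves.2 ⟨hwc, hw⟩, hvw⟩ hcT
        · obtain ⟨h1, h2⟩ := hleafTri c v w hcB hv hvw hw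
          simp [hS, h1, h2])
    rw [Finset.card_biUnion] at hI
    · rw [Finset.sum_congr rfl fun c hc =>
        (mem_fullCenters.1 (hp.mem_fullCenters_of_stuck (hSB c hc).1)).2] at hI
      simp [mul_comm] at hI
    · intro a _ b _ hab
      rw [Function.onFun, Finset.disjoint_left]
      intro v hva hvb
      exact hab ((mem_starLeaves.1 hva).2.symm.trans (mem_starLeaves.1 hvb).2)

end OptimalPacking

/-! ### From star packings to spanning trees -/

/-- A graph whose edges join vertices to their parents is acyclic if parents have smaller rank. -/
theorem isAcyclic_of_rank {V : Type*} {F : SimpleGraph V} (par : V → V) (rank : V → ℕ)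
    (h : ∀ u v, F.Adj u v → (v = par u ∧ rank v < rank u) ∨ (u = par v ∧ rank u < rank v)) :
    F.IsAcyclic := by
  classical
  intro a w hw
  obtain ⟨v, hv, hmax⟩ := w.support.toFinset.exists_max_image rank
    ⟨a, by simp⟩
  rw [List.mem_toFinset] at hv
  have hc := hw.rotate hv
  set c := w.rotate v hv
  have hpar : ∀ y, F.Adj v y → y ∈ w.support → y = par v := by
    intro y hvy hy
    rcases h v y hvy with h1 | h1
    · exact h1.1
    · exact absurd h1.2 (not_lt.2 (hmax y (by simpa using hy)))
  have hsup : ∀ y, y ∈ c.support → y ∈ w.support := by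
    intro y hy
    exact (SimpleGraph.Walk.mem_support_rotate_iff w v hv).1 hy
  have h1 := hpar c.snd (c.adj_snd hc.not_nil) (hsup _ (c.getVert_mem_support 1))
  have h2 := hpar c.penultimate (c.adj_penultimate hc.not_nil).symm
    (hsup _ (c.getVert_mem_support _))
  exact hc.snd_ne_penultimate (h1.trans h2.symm)

theorem IsLeaf.eq_of_adj {V : Type*} {T : SimpleGraph V} {w a b : V} (hw : IsLeaf T w)
    (ha : T.Adj w a) (hb : T.Adj w b) : a = b := by
  obtain ⟨x, hx⟩ := Set.ncard_eq_one.1 hw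
  have h1 : a ∈ T.neighborSet w := ha
  have h2 : b ∈ T.neighborSet w := hb
  rw [hx, Set.mem_singleton_iff] at h1 h2
  rw [h1, h2]

section Tree
variable {V : Type*} [Fintype V] [DecidableEq V] {G : SimpleGraph V} {m : ℕ} {p : V → V}

/-- If no star is stuck, every star with `m` leaves has an edge leaving one of its leaves and
ending in a star of lower level. -/
theorem exists_level_of_stuckCenters_eq_empty (h : stuckCenters G m p = ∅) :
    ∃ (lev : V → ℕ) (esc out : V → V), ∀ c, c ∈ fullCenters m p →
      esc c ∈ starLeaves p c ∧ G.Adj (esc c) (out c) ∧ lev (p (out c)) < lev c := by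
  classical
  have hesc : ∀ c, p c = c → ∃ n, EscapesIn G m p n c := by
    intro c hc
    by_contra hn
    push Not at hn
    have := mem_stuckCenters.2 ⟨hc, hn⟩
    simp [h] at this
  let lev : V → ℕ := fun c => if hc : ∃ n, EscapesIn G m p n c then Nat.find hc else 0
  have hlev : ∀ c n, EscapesIn G m p n c → lev c ≤ n := by
    intro c n hn
    have hc : ∃ n, EscapesIn G m p n c := ⟨n, hn⟩
    simp only [lev, dif_pos hc]
    exact Nat.find_min' hc hn
  have key : ∀ c, ∃ y : V × V, c ∈ fullCenters m p →
      y.1 ∈ starLeaves p c ∧ G.Adj y.1 y.2 ∧ lev (p y.2) < lev c := by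
    intro c
    by_cases hf : c ∈ fullCenters m p
    · have hf' := mem_fullCenters.1 hf
      have hc := hesc c hf'.1
      have hspec := Nat.find_spec hc
      have hl : lev c = Nat.find hc := by simp only [lev, dif_pos hc]
      rcases hn : Nat.find hc with _ | n
      · rw [hn] at hspec
        have := hspec.2
        lia
      · rw [hn] at hspec
        rcases hspec with hspec | ⟨-, u, hu, x, hux, hx⟩
        · exact absurd hspec (Nat.find_min hc (by lia))
        · exact ⟨(u, x), fun _ => ⟨hu, hux, by have := hlev _ _ hx; lia⟩⟩
    · exact ⟨(c, c), fun h => absurd h hf⟩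
  choose y hy using key
  exact ⟨lev, fun c => (y c).1, fun c => (y c).2, hy⟩

theorem IsStarPacking.exists_spanningTree (hp : IsStarPacking G m p) (hm : 2 ≤ m)
    (hG : G.Connected) (h : stuckCenters G m p = ∅) :
    ∃ T, IsSpanningTree T G ∧ leafDegree T ≤ m - 1 := by
  classical
  obtain ⟨lev, esc, out, hesc⟩ := exists_level_of_stuckCenters_eq_empty h
  -- A full star hangs from its escaping leaf, whose parent lies in a star of lower level; any other
  -- star is rooted at its centre. Ranks 0, 1, 2 inside a level order escaping leaf, centre,
  -- remaining leaves.
  let par : V → V := fun v => if p v ∈ fullCenters m p then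
    (if v = esc (p v) then out (p v) else if v = p v then esc v else p v) else p v
  let rank : V → ℕ := fun v => 3 * lev (p v) + if p v ∈ fullCenters m p ∧ v = esc (p v) then 0
    else if v = p v then 1 else 2
  have hrank_le : ∀ v, rank v ≤ 3 * lev (p v) + 2 := by
    intro v
    simp only [rank]
    split_ifs <;> lia
  have hpar : ∀ v, par v ≠ v → G.Adj v (par v) ∧ rank (par v) < rank v := by
    intro v hv
    by_cases hf : p v ∈ fullCenters m p
    · obtain ⟨he1, he2, he3⟩ := hesc _ hf
      have he1' := mem_starLeaves.1 he1
      by_cases h1 : v = esc (p v)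
      · have e1 : par v = out (p v) := by simp only [par, if_pos hf, if_pos h1]
        rw [e1]
        refine ⟨by rw [← h1] at he2; exact he2, ?_⟩
        have e2 : rank v = 3 * lev (p v) := by simp only [rank, if_pos (And.intro hf h1)]; lia
        have := hrank_le (out (p v))
        lia
      · by_cases h2 : v = p v
        · have e1 : par v = esc v := by simp only [par, if_pos hf, if_neg h1, if_pos h2]
          rw [e1]
          rw [← h2] at he1' hf
          have e3 : rank (esc v) = 3 * lev (p (esc v)) := by
            simp only [rank]
            rw [if_pos]
            · rfl
            · rw [he1'.2]; exact ⟨hf, rfl⟩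
          have e2 : rank v = 3 * lev (p v) + 1 := by
            simp only [rank]
            rw [if_neg fun h => h1 h.2, if_pos h2]
          refine ⟨?_, ?_⟩
          · have := hp.adj (esc v) (by rw [he1'.2]; exact he1'.1.symm)
            rw [he1'.2] at this
            exact this.symm
          · rw [e3, e2, he1'.2, ← h2]; lia
        · have e1 : par v = p v := by simp only [par, if_pos hf, if_neg h1, if_neg h2]
          have e2 : rank v = 3 * lev (p v) + 2 := by
            simp only [rank]
            rw [if_neg fun h => h1 h.2, if_neg h2]
          have e3 : rank (p v) ≤ 3 * lev (p v) + 1 := by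
            simp only [rank, hp.idem]
            split_ifs <;> lia
          rw [e1]
          exact ⟨hp.adj v fun h => h2 h.symm, by lia⟩
    · have e1 : par v = p v := by simp only [par, if_neg hf]
      rw [e1] at hv ⊢
      refine ⟨hp.adj v hv, ?_⟩
      have e2 : rank v = 3 * lev (p v) + 2 := by
        simp only [rank]
        rw [if_neg fun h => hf h.1, if_neg hv.symm]
      have e3 : rank (p v) ≤ 3 * lev (p v) + 1 := by
        simp only [rank, hp.idem]
        split_ifs <;> lia
      lia
  let F : SimpleGraph V := SimpleGraph.fromRel fun u v => v = par u
  have hFadj : ∀ v, par v ≠ v → F.Adj v (par v) := fun v hv =>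
    (SimpleGraph.fromRel_adj _ _ _).2 ⟨hv.symm, Or.inl rfl⟩
  have hFG : F ≤ G := by
    intro u v huv
    obtain ⟨hne, h | h⟩ := (SimpleGraph.fromRel_adj _ _ _).1 huv
    · rw [h]; exact (hpar u (h ▸ hne.symm)).1
    · rw [h]; exact (hpar v (h ▸ hne)).1.symm
  have hFac : F.IsAcyclic := by
    refine isAcyclic_of_rank par rank fun u v huv => ?_
    obtain ⟨hne, h | h⟩ := (SimpleGraph.fromRel_adj _ _ _).1 huv
    · exact Or.inl ⟨h, h ▸ (hpar u (h ▸ hne.symm)).2⟩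
    · exact Or.inr ⟨h, h ▸ (hpar v (h ▸ hne)).2⟩
  have hstar : ∀ v, p v ≠ v → F.Adj v (p v) := by
    intro v hv
    by_cases hf : p v ∈ fullCenters m p
    · by_cases h1 : v = esc (p v)
      · have e : par (p v) = v := by
          simp only [par, hp.idem, if_pos hf]
          rw [if_neg (by rw [← h1]; exact hv)]
          simp [← h1]
        have := hFadj (p v) (by rw [e]; exact hv.symm)
        rw [e] at this
        exact this.symm
      · have e : par v = p v := by simp only [par, if_pos hf, if_neg h1, if_neg hv.symm]
        have := hFadj v (by rw [e]; exact hv)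
        rwa [e] at this
    · have e : par v = p v := by simp only [par, if_neg hf]
      have := hFadj v (by rw [e]; exact hv)
      rwa [e] at this
  obtain ⟨T, hFT, hTG, hT⟩ := hG.exists_isTree_le_of_le_of_isAcyclic hFG hFac
  refine ⟨T, ⟨hTG, hT⟩, Finset.sup_le fun v _ => ?_⟩
  -- `T` contains all star edges, so the only neighbour of a leaf of `T` lies in the same star.
  have hleaf : ∀ w, T.Adj v w → IsLeaf T w → (p w ≠ w ∧ p w = v) ∨ p v = w := by
    intro w hvw hw
    by_cases hpw : p w = w
    · obtain ⟨u, hu⟩ := hp.nonempty w hpw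
      have hu' := mem_starLeaves.1 hu
      have h1 := hFT (hstar u (by rw [hu'.2]; exact hu'.1.symm))
      rw [hu'.2] at h1
      right
      rw [hw.eq_of_adj hvw.symm h1.symm, hu'.2]
    · exact Or.inl ⟨hpw, hw.eq_of_adj (hFT (hstar w hpw)) hvw.symm⟩
  unfold vertexLeafDegree
  by_cases hv : p v = v
  · have hsub : {w : V | T.Adj v w ∧ IsLeaf T w} ⊆ (starLeaves p v : Set V) := by
      rintro w ⟨hvw, hw⟩
      rw [Finset.mem_coe, mem_starLeaves]
      rcases hleaf w hvw hw with h | h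
      · exact ⟨hvw.ne', h.2⟩
      · exact absurd (hv.symm.trans h) hvw.ne
    by_cases hf : v ∈ fullCenters m p
    · obtain ⟨he1, he2, he3⟩ := hesc _ hf
      have he1' := mem_starLeaves.1 he1
      -- In a full star the escaping leaf also has its outgoing edge, so it is no leaf of `T`.
      have hsub' : {w : V | T.Adj v w ∧ IsLeaf T w} ⊆ (((starLeaves p v).erase (esc v) : Finset V) : Set V) := by
        rintro w ⟨hvw, hw⟩
        refine Finset.mem_erase.2 ⟨?_, hsub ⟨hvw, hw⟩⟩
        rintro rfl
        have e : par (esc v) = out v := by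
          simp only [par, he1'.2, if_pos hf, if_true]
        have h1 := hFadj (esc v) (by rw [e]; exact he2.ne')
        rw [e] at h1
        have h2 := hw.eq_of_adj hvw.symm (hFT h1)
        rw [← h2, hv] at he3
        exact lt_irrefl _ he3
      have h1 := Set.ncard_le_ncard hsub' (Finset.finite_toSet _)
      rw [Set.ncard_coe_finset, Finset.card_erase_of_mem he1, (mem_fullCenters.1 hf).2] at h1
      exact h1
    · have h1 := Set.ncard_le_ncard hsub (Finset.finite_toSet _)
      rw [Set.ncard_coe_finset] at h1
      have h2 := hp.bound v
      have h3 : (starLeaves p v).card ≠ m := fun h => hf (mem_fullCenters.2 ⟨hv, h⟩)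
      lia
  · have hsub : {w : V | T.Adj v w ∧ IsLeaf T w} ⊆ {p v} := by
      rintro w ⟨hvw, hw⟩
      rcases hleaf w hvw hw with h | h
      · exact absurd (by rw [← h.2, hp.idem]) hv
      · exact h.symm
    have h1 := Set.ncard_le_ncard hsub (Set.finite_singleton _)
    rw [Set.ncard_singleton] at h1
    lia

end Tree

/-- Sufficiency in Kaneko's theorem on spanning trees with bounded leaf degree. -/
theorem IsolatedBound.exists_spanningTree {V : Type*} [Fintype V] {G : SimpleGraph V} {k : ℕ}
    (hiso : IsolatedBound G (k + 1)) (hk : 1 ≤ k) (hG : G.Connected)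
    (hcard : 4 ≤ Fintype.card V) : ∃ T, IsSpanningTree T G ∧ leafDegree T ≤ k := by
  classical
  have : Nontrivial V := Fintype.one_lt_card_iff_nontrivial.1 (by lia)
  obtain ⟨p, hp⟩ := exists_isOptimalPacking (hiso.exists_isStarPacking (by lia) fun v =>
    hG.preconnected.exists_adj_of_nontrivial v)
  exact hp.exists_spanningTree (by lia) hG (hp.stuckCenters_eq_empty (by lia) hG hcard hiso)

/-! ### Necessity of the isolated-vertex bound -/

/-- Parents in a rooted tree are unique: both geodesics extend to the one path from `r` to `v`. -/
theorem _root_.SimpleGraph.IsTree.eq_of_adj_of_dist {V : Type*} {T : SimpleGraph V} (hT : T.IsTree)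
    {r v a b : V} (ha : T.Adj a v) (hb : T.Adj b v) (hda : T.dist r v = T.dist r a + 1)
    (hdb : T.dist r v = T.dist r b + 1) : a = b := by
  obtain ⟨p, hp⟩ := hT.connected.exists_walk_length_eq_dist r a
  obtain ⟨q, hq⟩ := hT.connected.exists_walk_length_eq_dist r b
  have h1 : (p.concat ha).IsPath := SimpleGraph.Walk.isPath_of_length_eq_dist _ (by simp [hp, hda])
  have h2 : (q.concat hb).IsPath := SimpleGraph.Walk.isPath_of_length_eq_dist _ (by simp [hq, hdb])
  have h3 := (hT.existsUnique_path r v).unique h1 h2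
  have h4 := congrArg SimpleGraph.Walk.penultimate h3
  simpa using h4

/-- Necessity in Kaneko's theorem on spanning trees with bounded leaf degree. -/
theorem IsSpanningTree.isolatedBound {V : Type*} [Fintype V] {T G : SimpleGraph V} {k : ℕ}
    (hT : IsSpanningTree T G) (hk : leafDegree T ≤ k) : IsolatedBound G (k + 1) := by
  classical
  rintro S I ⟨r, hr⟩ hI
  obtain ⟨hTG, hT⟩ := hT
  have hnbr : ∀ v ∈ I, ∃ w, T.Adj v w := by
    intro v hv
    have hne : v ≠ r := by rintro rfl; exact (hI v hv).1 hr
    have : Nontrivial V := ⟨⟨v, r, hne⟩⟩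
    exact hT.connected.preconnected.exists_adj_of_nontrivial v
  have hleaves : (I.filter fun v => IsLeaf T v).card ≤ k * S.card := by
    have hsub : (I.filter fun v => IsLeaf T v) ⊆
        S.biUnion fun s => Finset.univ.filter fun w => T.Adj s w ∧ IsLeaf T w := by
      intro v hv
      obtain ⟨hv, hl⟩ := Finset.mem_filter.1 hv
      obtain ⟨w, hw⟩ := hnbr v hv
      simp only [Finset.mem_biUnion, Finset.mem_filter, Finset.mem_univ, true_and]
      exact ⟨w, (hI v hv).2 w (hTG hw), hw.symm, hl⟩
    refine (Finset.card_le_card hsub).trans ?_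
    rw [mul_comm]
    refine Finset.card_biUnion_le_card_mul _ _ _ fun s _ => ?_
    have h1 : vertexLeafDegree T s ≤ leafDegree T := Finset.le_sup (Finset.mem_univ s)
    have h2 : (Finset.univ.filter fun w => T.Adj s w ∧ IsLeaf T w).card = vertexLeafDegree T s := by
      unfold vertexLeafDegree
      rw [← Set.ncard_coe_finset]
      simp
    lia
  have hchild : ∀ v, ∃ w, v ∈ I.filter (fun v => ¬ IsLeaf T v) →
      T.Adj v w ∧ T.dist r w = T.dist r v + 1 := by
    intro v
    by_cases hv : v ∈ I.filter (fun v => ¬ IsLeaf T v)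
    · obtain ⟨hvI, hl⟩ := Finset.mem_filter.1 hv
      obtain ⟨a, ha⟩ := hnbr v hvI
      have hb : ∃ b, T.Adj v b ∧ b ≠ a := by
        by_contra hcon
        push Not at hcon
        refine hl (Set.ncard_eq_one.2 ⟨a, ?_⟩)
        ext b
        simp only [SimpleGraph.mem_neighborSet, Set.mem_singleton_iff]
        exact ⟨hcon b, fun h => h ▸ ha⟩
      obtain ⟨b, hb, hba⟩ := hb
      rcases hT.dist_eq_dist_add_one_of_adj r ha with h1 | h1
      · rcases hT.dist_eq_dist_add_one_of_adj r hb with h2 | h2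
        · exact absurd (hT.eq_of_adj_of_dist hb.symm ha.symm h2 h1) hba
        · exact ⟨b, fun _ => ⟨hb, h2⟩⟩
      · exact ⟨a, fun _ => ⟨ha, h1⟩⟩
    · exact ⟨v, fun h => absurd h hv⟩
  choose ch hch using hchild
  -- Each non-leaf of `I` has a child, which lies in `S`; children of different vertices differ and
  -- none is the root `r`. This saves the one needed for strictness.
  have hnon : (I.filter fun v => ¬ IsLeaf T v).card ≤ (S.erase r).card := by
    refine Finset.card_le_card_of_injOn ch (fun v hv => ?_) fun v hv v' hv' hvv => ?_
    · obtain ⟨h1, h2⟩ := hch v hv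
      rw [Finset.mem_coe, Finset.mem_erase]
      refine ⟨?_, (hI v (Finset.mem_filter.1 hv).1).2 _ (hTG h1)⟩
      intro h
      rw [h, SimpleGraph.dist_self] at h2
      lia
    · obtain ⟨h1, h2⟩ := hch v hv
      obtain ⟨h1', h2'⟩ := hch v' hv'
      rw [← hvv] at h1' h2'
      exact hT.eq_of_adj_of_dist h1 h1' h2 h2'
  have h1 := Finset.card_filter_add_card_filter_not (s := I) (fun v => IsLeaf T v)
  rw [Finset.card_erase_of_mem hr] at hnon
  have h2 := Finset.card_pos.2 ⟨r, hr⟩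
  rw [add_mul, one_mul]
  lia

/-! ### Comparison of adjacency eigenvalues -/

section Spectral
variable {V : Type*} [Fintype V]

open Classical in
/-- The adjacency operator: the sum of a function over the neighbours of a vertex. -/
noncomputable def nbrSum (G : SimpleGraph V) (x : V → ℝ) (v : V) : ℝ :=
  ∑ w, if G.Adj v w then x w else 0

theorem mem_adjEigenvalues_iff {G : SimpleGraph V} {μ : ℝ} :
    μ ∈ adjEigenvalues G ↔ ∃ x : V → ℝ, x ≠ 0 ∧ ∀ v, nbrSum G x v = μ * x v := by
  classical
  have key : ∀ x : V → ℝ, (Matrix.toLin' (G.adjMatrix ℝ)) x = μ • x ↔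
      ∀ v, nbrSum G x v = μ * x v := by
    intro x
    rw [funext_iff]
    refine forall_congr' fun v => ?_
    simp only [Matrix.toLin'_apply, Matrix.mulVec, dotProduct, SimpleGraph.adjMatrix_apply,
      ite_mul, one_mul, zero_mul, Pi.smul_apply, smul_eq_mul, nbrSum]
  unfold adjEigenvalues
  constructor
  · intro h
    have h' : Module.End.HasEigenvalue (Matrix.toLin' (G.adjMatrix ℝ)) μ := by convert h
    obtain ⟨x, hx⟩ := h'.exists_hasEigenvector
    exact ⟨x, hx.2, (key x).1 (Module.End.mem_eigenspace_iff.1 hx.1)⟩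
  · rintro ⟨x, hx0, hx⟩
    have h' : Module.End.HasEigenvalue (Matrix.toLin' (G.adjMatrix ℝ)) μ :=
      Module.End.hasEigenvalue_of_hasEigenvector
        ⟨Module.End.mem_eigenspace_iff.2 ((key x).2 hx), hx0⟩
    convert h'

theorem sum_mul_nbrSum_comm (G : SimpleGraph V) (x y : V → ℝ) :
    ∑ v, y v * nbrSum G x v = ∑ v, x v * nbrSum G y v := by
  classical
  simp only [nbrSum, Finset.mul_sum]
  rw [Finset.sum_comm]
  refine Finset.sum_congr rfl fun v _ => Finset.sum_congr rfl fun w _ => ?_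
  by_cases h : G.Adj v w
  · simp [h, h.symm, mul_comm]
  · have h' : ¬ G.Adj w v := fun h' => h h'.symm
    simp [h, h']

/-- A positive supersolution at level `r` of the adjacency operator of a connected graph is a
solution if the graph has an eigenvalue at least `r`. -/
theorem nbrSum_eq_of_nbrSum_le {G : SimpleGraph V} (hG : G.Connected) {x : V → ℝ} {r μ : ℝ}
    (hx : ∀ v, 0 < x v) (hle : ∀ v, nbrSum G x v ≤ r * x v) (hμ : μ ∈ adjEigenvalues G)
    (hr : r ≤ μ) (v : V) : nbrSum G x v = r * x v := by
  classical
  obtain ⟨u, hu0, hu⟩ := mem_adjEigenvalues_iff.1 hμ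
  set y : V → ℝ := fun v => |u v| with hy
  have hy0 : ∀ v, 0 ≤ y v := fun v => abs_nonneg _
  have hyle : ∀ v, r * y v ≤ nbrSum G y v := by
    intro v
    calc r * y v ≤ |μ| * |u v| :=
          mul_le_mul_of_nonneg_right (hr.trans (le_abs_self _)) (hy0 v)
      _ = |nbrSum G u v| := by rw [hu v, abs_mul]
      _ ≤ nbrSum G y v := by
          refine (Finset.abs_sum_le_sum_abs _ _).trans (le_of_eq ?_)
          refine Finset.sum_congr rfl fun w _ => ?_
          split_ifs <;> simp [hy]
  have hsum := sum_mul_nbrSum_comm G x y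
  have h1 : ∀ v, 0 ≤ y v * (r * x v - nbrSum G x v) := fun v =>
    mul_nonneg (hy0 v) (sub_nonneg.2 (hle v))
  have h2 : ∀ v, 0 ≤ x v * (nbrSum G y v - r * y v) := fun v =>
    mul_nonneg (hx v).le (sub_nonneg.2 (hyle v))
  -- By symmetry of the adjacency operator `A`, `⟨y, (r - A)x⟩ + ⟨x, (A - r)y⟩ = 0`. All terms are
  -- nonnegative, so all vanish; then `y` is an eigenvector, nowhere zero by connectedness.
  have h3 : ∑ v, y v * (r * x v - nbrSum G x v) + ∑ v, x v * (nbrSum G y v - r * y v) = 0 := by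
    simp only [mul_sub, Finset.sum_sub_distrib, hsum]
    have : ∑ v, y v * (r * x v) = ∑ v, x v * (r * y v) :=
      Finset.sum_congr rfl fun v _ => by ring
    rw [this]; ring
  have h4 := Finset.sum_nonneg fun v (_ : v ∈ Finset.univ) => h1 v
  have h5 := Finset.sum_nonneg fun v (_ : v ∈ Finset.univ) => h2 v
  have h6 : ∀ v, y v * (r * x v - nbrSum G x v) = 0 := fun v =>
    (Finset.sum_eq_zero_iff_of_nonneg fun v _ => h1 v).1 (by linarith) v (Finset.mem_univ v)
  have h7 : ∀ v, nbrSum G y v = r * y v := by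
    intro v
    have := (Finset.sum_eq_zero_iff_of_nonneg fun v _ => h2 v).1 (by linarith) v (Finset.mem_univ v)
    have := (mul_eq_zero.1 this).resolve_left (hx v).ne'
    linarith
  obtain ⟨a, ha⟩ := Function.ne_iff.1 hu0
  have hypos : y v ≠ 0 := by
    refine forall_of_connected_of_adj hG (P := fun v => y v ≠ 0) (abs_ne_zero.2 ha) ?_ v
    intro a b ha hab hb
    have h8 := h7 b
    rw [hb, mul_zero] at h8
    have h9 := (Finset.sum_eq_zero_iff_of_nonneg fun w _ => by
      split_ifs
      · exact hy0 w
      · exact le_rfl).1 h8 a (Finset.mem_univ a)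
    rw [if_pos hab.symm] at h9
    exact ha h9
  have := (mul_eq_zero.1 (h6 v)).resolve_left hypos
  linarith

/-- The largest graph in which `I` is an independent set with all neighbours in `S`. -/
def splitGraph {V : Type*} (S I : Finset V) : SimpleGraph V where
  Adj u v := u ≠ v ∧ (u ∈ S ∨ v ∈ S ∨ (u ∉ I ∧ v ∉ I))
  symm := ⟨fun u v h => ⟨h.1.symm, by tauto⟩⟩
  loopless := ⟨fun u h => h.1 rfl⟩

theorem le_splitGraph {V : Type*} {G : SimpleGraph V} {S I : Finset V}
    (h : ∀ v ∈ I, ∀ w, G.Adj v w → w ∈ S) : G ≤ splitGraph S I := by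
  intro u v huv
  refine ⟨huv.ne, ?_⟩
  by_cases hu : u ∈ I
  · exact Or.inr (Or.inl (h u hu v huv))
  · by_cases hv : v ∈ I
    · exact Or.inl (h v hv u huv.symm)
    · exact Or.inr (Or.inr ⟨hu, hv⟩)

theorem nbrSum_mono {G H : SimpleGraph V} (h : G ≤ H) {x : V → ℝ} (hx : ∀ v, 0 ≤ x v) (v : V) :
    nbrSum G x v ≤ nbrSum H x v := by
  classical
  refine Finset.sum_le_sum fun w _ => ?_
  by_cases h1 : G.Adj v w
  · rw [if_pos h1, if_pos (h h1)]
  · rw [if_neg h1]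
    split_ifs
    · exact hx w
    · exact le_rfl

theorem adj_of_nbrSum_eq {G H : SimpleGraph V} (h : G ≤ H) {x : V → ℝ} (hx : ∀ v, 0 < x v) {v : V}
    (heq : nbrSum G x v = nbrSum H x v) {w : V} (hw : H.Adj v w) : G.Adj v w := by
  classical
  have := (Finset.sum_eq_sum_iff_of_le fun w _ => by
    by_cases h1 : G.Adj v w
    · rw [if_pos h1, if_pos (h h1)]
    · rw [if_neg h1]
      split_ifs
      · exact (hx w).le
      · exact le_rfl).1 heq w (Finset.mem_univ w)
  by_contra hn
  rw [if_neg hn, if_pos hw] at this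
  exact (hx w).ne this

open Classical in
/-- The function with value `1` on `S`, `z` on `I` and `y` elsewhere. -/
noncomputable def splitVector {V : Type*} (S I : Finset V) (z y : ℝ) (v : V) : ℝ :=
  if v ∈ S then 1 else if v ∈ I then z else y

section SplitVector
variable {S I : Finset V} (z y : ℝ)

theorem sum_splitVector (hSI : Disjoint S I) :
    ∑ v, splitVector S I z y v =
      S.card + I.card * z + (Fintype.card V - S.card - I.card) * y := by
  classical
  have h1 : ∀ v, splitVector S I z y v =
      y + (if v ∈ S then 1 - y else 0) + (if v ∈ I then z - y else 0) := by
    intro v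
    unfold splitVector
    by_cases hS : v ∈ S
    · simp [hS, Finset.disjoint_left.1 hSI hS]
    · by_cases hI : v ∈ I <;> simp [hS, hI]
  simp only [h1, Finset.sum_add_distrib, Finset.sum_const, Finset.card_univ, nsmul_eq_mul,
    Finset.sum_ite_mem, Finset.univ_inter]
  ring

theorem nbrSum_splitVector_of_mem_left (hSI : Disjoint S I) {v : V} (hv : v ∈ S) :
    nbrSum (splitGraph S I) (splitVector S I z y) v =
      S.card + I.card * z + (Fintype.card V - S.card - I.card) * y - 1 := by
  classical
  rw [← sum_splitVector z y hSI, nbrSum, eq_sub_iff_add_eq]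
  have : (1 : ℝ) = ∑ w, if w = v then splitVector S I z y w else 0 := by
    simp [splitVector, hv]
  rw [this, ← Finset.sum_add_distrib]
  refine Finset.sum_congr rfl fun w _ => ?_
  by_cases h : w = v
  · simp [h]
  · have : (splitGraph S I).Adj v w := ⟨fun h' => h h'.symm, Or.inl hv⟩
    simp [h, this]

theorem nbrSum_splitVector_of_mem_right (hSI : Disjoint S I) {v : V} (hv : v ∈ I) :
    nbrSum (splitGraph S I) (splitVector S I z y) v = S.card := by
  classical
  have hvS := Finset.disjoint_right.1 hSI hv
  have : ∀ w, (if (splitGraph S I).Adj v w then splitVector S I z y w else 0) =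
      if w ∈ S then 1 else 0 := by
    intro w
    by_cases hw : w ∈ S
    · have h1 : (splitGraph S I).Adj v w :=
        ⟨fun h => hvS (h ▸ hw), Or.inr (Or.inl hw)⟩
      simp [h1, hw, splitVector]
    · have h1 : ¬ (splitGraph S I).Adj v w := fun h => by
        have := h.2
        tauto
      simp [h1, hw]
  rw [nbrSum, Finset.sum_congr rfl fun w _ => this w]
  simp

theorem nbrSum_splitVector_of_notMem (hSI : Disjoint S I) {v : V} (hvS : v ∉ S) (hvI : v ∉ I) :
    nbrSum (splitGraph S I) (splitVector S I z y) v =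
      S.card + (Fintype.card V - S.card - I.card) * y - y := by
  classical
  have h0 := sum_splitVector z y hSI
  rw [nbrSum]
  have h1 : y = ∑ w, if w = v then splitVector S I z y w else 0 := by
    simp [splitVector, hvS, hvI]
  have h2 : (I.card : ℝ) * z = ∑ w, if w ∈ I then splitVector S I z y w else 0 := by
    have : ∀ w, (if w ∈ I then splitVector S I z y w else 0) = if w ∈ I then z else 0 := by
      intro w
      by_cases hw : w ∈ I
      · simp [hw, splitVector, Finset.disjoint_right.1 hSI hw]
      · simp [hw]
    rw [Finset.sum_congr rfl fun w _ => this w]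
    simp
  have h3 : ∑ w, (if (splitGraph S I).Adj v w then splitVector S I z y w else 0) +
      (∑ w, (if w = v then splitVector S I z y w else 0) +
      ∑ w, if w ∈ I then splitVector S I z y w else 0) = ∑ w, splitVector S I z y w := by
    rw [← Finset.sum_add_distrib, ← Finset.sum_add_distrib]
    refine Finset.sum_congr rfl fun w _ => ?_
    by_cases h : w = v
    · subst h
      simp [hvI]
    · by_cases hw : w ∈ I
      · have : ¬ (splitGraph S I).Adj v w := fun h' => by
          have h1 := h'.2
          have h2 := Finset.disjoint_right.1 hSI hw
          tauto
        simp [this, h, hw]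
      · have : (splitGraph S I).Adj v w := ⟨fun h' => h h'.symm, Or.inr (Or.inr ⟨hvI, hw⟩)⟩
        simp [this, h, hw]
  linarith

end SplitVector

/-! ### The quotient polynomial and the extremal graph -/

/-- The characteristic polynomial of the quotient matrix of `K_s ∨ (K_b + I_{qs})` on
`n = b + (q + 1) s` vertices. -/
def quotientPoly (q n s x : ℝ) : ℝ :=
  (x ^ 2 - (s - 1) * x - q * s ^ 2) * (x - (n - (q + 1) * s) + 1) - (n - (q + 1) * s) * s * x

theorem sub_eq_quotientPoly_div {q n s r : ℝ} (hr : r ≠ 0) (hd : r - (n - (q + 1) * s) + 1 ≠ 0) :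
    r * 1 - (s + q * s * (s / r) + (n - s - q * s) * (s / (r - (n - (q + 1) * s) + 1)) - 1) =
      quotientPoly q n s r / (r * (r - (n - (q + 1) * s) + 1)) := by
  obtain ⟨d, hdn⟩ : ∃ d, d = r - (n - (q + 1) * s) + 1 := ⟨_, rfl⟩
  obtain rfl : n = r - d + 1 + (q + 1) * s := by linarith
  rw [← hdn] at hd ⊢
  unfold quotientPoly
  field_simp
  ring

/-- The vector equals 1 on `S` and solves the eigenvalue equation at level `r` exactly off `S`; its
defect on `S` has the sign of `quotientPoly`. It is thus a positive supersolution for `splitGraph S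
I`, hence for `G`, and equality there forces every edge to be present. -/
theorem eq_splitGraph_of_le {G : SimpleGraph V} (hG : G.Connected) {S I : Finset V} {q : ℕ}
    (hS : S.Nonempty) (hSI : Disjoint S I) (hI : I.card = q * S.card)
    (hGS : G ≤ splitGraph S I) {r μ : ℝ} (hr : 0 < r)
    (hrb : (Fintype.card V : ℝ) - (q + 1) * S.card - 1 < r)
    (hpoly : 0 ≤ quotientPoly q (Fintype.card V) S.card r) (hμ : μ ∈ adjEigenvalues G)
    (hrμ : r ≤ μ) : quotientPoly q (Fintype.card V) S.card r = 0 ∧ G = splitGraph S I := by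
  classical
  obtain ⟨v₀, hv₀⟩ := hS
  have hs : (0 : ℝ) < S.card := by exact_mod_cast Finset.card_pos.2 ⟨v₀, hv₀⟩
  set n : ℝ := (Fintype.card V : ℝ)
  set s : ℝ := (S.card : ℝ) with hsdef
  have hIc : (I.card : ℝ) = q * s := by rw [hI]; push_cast; rfl
  have hd : 0 < r - (n - (q + 1) * s) + 1 := by linarith
  set x := splitVector S I (s / r) (s / (r - (n - (q + 1) * s) + 1)) with hxdef
  have hx : ∀ v, 0 < x v := by
    intro v
    simp only [hxdef, splitVector]
    split_ifs <;> positivity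
  have hSval : ∀ v ∈ S, r * x v - nbrSum (splitGraph S I) x v =
      quotientPoly q n s r / (r * (r - (n - (q + 1) * s) + 1)) := by
    intro v hv
    rw [hxdef, nbrSum_splitVector_of_mem_left _ _ hSI hv, hIc]
    simp only [splitVector, if_pos hv]
    exact sub_eq_quotientPoly_div hr.ne' hd.ne'
  have hle : ∀ v, nbrSum (splitGraph S I) x v ≤ r * x v := by
    intro v
    by_cases hvS : v ∈ S
    · have h1 := hSval v hvS
      have h2 : 0 ≤ quotientPoly q n s r / (r * (r - (n - (q + 1) * s) + 1)) := by positivity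
      linarith
    · by_cases hvI : v ∈ I
      · rw [hxdef, nbrSum_splitVector_of_mem_right _ _ hSI hvI]
        simp only [splitVector, if_neg hvS, if_pos hvI]
        rw [mul_div_cancel₀ _ hr.ne']
      · rw [hxdef, nbrSum_splitVector_of_notMem _ _ hSI hvS hvI, hIc]
        simp only [splitVector, if_neg hvS, if_neg hvI]
        change s + (n - s - q * s) * (s / (r - (n - (q + 1) * s) + 1)) - _ ≤ _
        have := div_mul_cancel₀ s hd.ne'
        linarith
  have heq := nbrSum_eq_of_nbrSum_le hG hx
    (fun v => (nbrSum_mono hGS (fun v => (hx v).le) v).trans (hle v)) hμ hrμ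
  have heq' : ∀ v, nbrSum G x v = nbrSum (splitGraph S I) x v := fun v =>
    le_antisymm (nbrSum_mono hGS (fun v => (hx v).le) v) (heq v ▸ hle v)
  constructor
  · have h1 := hSval v₀ hv₀
    rw [← heq', heq, sub_self] at h1
    rcases div_eq_zero_iff.1 h1.symm with h | h
    · exact h
    · exact absurd h (by positivity)
  · exact le_antisymm hGS fun v w hvw => adj_of_nbrSum_eq hGS hx (heq' v) hvw

theorem nbrSum_eq_sum {G : SimpleGraph V} {x g : V → ℝ} {v : V}
    (h : ∀ w, G.Adj v w ∧ g w = x w ∨ ¬ G.Adj v w ∧ g w = 0) : nbrSum G x v = ∑ w, g w := by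
  classical
  refine Finset.sum_congr rfl fun w _ => ?_
  rcases h w with h | h
  · rw [if_pos h.1, h.2]
  · rw [if_neg h.1, h.2]

/-- The same vector is an eigenvector once the polynomial vanishes. -/
theorem mem_adjEigenvalues_joinCompleteUnion {a b c : ℕ} {q r : ℝ} (ha : 0 < a) (hr : 0 < r)
    (hc : (c : ℝ) = q * a) (hrb : (b : ℝ) - 1 < r)
    (hpoly : quotientPoly q (b + (q + 1) * a) a r = 0) :
    r ∈ adjEigenvalues (joinCompleteUnion a b c) := by
  classical
  have hd : 0 < r - b + 1 := by linarith
  have hap : (0 : ℝ) < a := by exact_mod_cast ha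
  rw [mem_adjEigenvalues_iff]
  refine ⟨Sum.elim (fun _ => 1) (Sum.elim (fun _ => a / (r - b + 1)) (fun _ => a / r)), ?_, ?_⟩
  · intro h
    have := congrFun h (Sum.inl ⟨0, ha⟩)
    simp at this
  · rintro (i | i | i)
    · rw [nbrSum_eq_sum (g := Sum.elim (fun j => 1 - if j = i then 1 else 0)
        (Sum.elim (fun _ => a / (r - b + 1)) (fun _ => a / r)))]
      · simp only [Fintype.sum_sum_type, Sum.elim_inl, Sum.elim_inr, Finset.sum_sub_distrib,
          Finset.sum_ite_eq', Finset.mem_univ, if_true, Finset.sum_const, Finset.card_univ,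
          Fintype.card_fin, nsmul_eq_mul, mul_one]
        unfold quotientPoly at hpoly
        rw [hc]
        have h2 : r * (r - b + 1) *
            (a - 1 + (b * (a / (r - b + 1)) + q * a * (a / r)) - r) = 0 := by
          have : r * (r - b + 1) * (a - 1 + (b * (a / (r - b + 1)) + q * a * (a / r)) - r) =
              -((r ^ 2 - (a - 1) * r - q * a ^ 2) * (r - b + 1) - b * a * r) := by
            field_simp
            ring
          rw [this]
          ring_nf at hpoly ⊢
          linarith
        have := (mul_eq_zero.1 h2).resolve_left (by positivity)
        linarith
      · rintro (j | j | j)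
        · by_cases h : j = i
          · right; simp [h]
          · left; simp [h, joinCompleteUnion, join, Ne.symm h]
        · left; simp [joinCompleteUnion, join]
        · left; simp [joinCompleteUnion, join]
    · rw [nbrSum_eq_sum (g := Sum.elim (fun _ => 1)
        (Sum.elim (fun j => a / (r - b + 1) - if j = i then a / (r - b + 1) else 0)
          (fun _ => 0)))]
      · simp only [Fintype.sum_sum_type, Sum.elim_inl, Sum.elim_inr, Finset.sum_sub_distrib,
          Finset.sum_ite_eq', Finset.mem_univ, if_true, Finset.sum_const, Finset.card_univ,
          Fintype.card_fin, nsmul_eq_mul, mul_one, mul_zero]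
        field_simp
        ring
      · rintro (j | j | j)
        · left; simp [joinCompleteUnion, join]
        · by_cases h : j = i
          · right; simp [h]
          · left; simp [h, joinCompleteUnion, join, Ne.symm h]
        · right; simp [joinCompleteUnion, join]
    · rw [nbrSum_eq_sum (g := Sum.elim (fun _ => 1) (fun _ => 0))]
      · simp only [Fintype.sum_sum_type, Sum.elim_inl, Sum.elim_inr, Finset.sum_const,
          Finset.card_univ, Fintype.card_fin, nsmul_eq_mul, mul_one, mul_zero]
        field_simp
        ring
      · rintro (j | j | j)
        · left; simp [joinCompleteUnion, join]
        · right; simp [joinCompleteUnion, join]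
        · right; simp [joinCompleteUnion, join]

/-- Intermediate values on `[n - q * d - 1, n]`. The left end is the spectral radius of the clique
on `n - q * d` vertices inside the extremal graph. -/
theorem exists_quotientPoly_root {q n d : ℝ} (hq : 2 ≤ q) (hd : 1 ≤ d)
    (hn : 3 * (q + 1) * d + 2 ≤ n) : ∃ r, n - q * d - 1 < r ∧ quotientPoly q n d r = 0 := by
  have hcont : Continuous (quotientPoly q n d) := by unfold quotientPoly; fun_prop
  have hlo : quotientPoly q n d (n - q * d - 1) < 0 := by
    have : quotientPoly q n d (n - q * d - 1) = - (q * d ^ 3) := by unfold quotientPoly; ring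
    rw [this]
    have : 0 < q * d ^ 3 := by positivity
    linarith
  have hqd : 0 ≤ q * d := by positivity
  have h9 : 9 * d ≤ n := by nlinarith
  have hn0 : 0 < n := by linarith
  have hhi : 0 ≤ quotientPoly q n d n := by
    have h1 : n ^ 2 / 2 ≤ n ^ 2 - (d - 1) * n - q * d ^ 2 := by
      have e1 : q * d * d ≤ n * d := by
        apply mul_le_mul_of_nonneg_right _ (by linarith)
        linarith
      have e2 : 9 * d * n ≤ n * n := mul_le_mul_of_nonneg_right h9 hn0.le
      nlinarith
    have h2 : quotientPoly q n d n = (n ^ 2 - (d - 1) * n - q * d ^ 2) * ((q + 1) * d + 1) -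
        (n - (q + 1) * d) * d * n := by unfold quotientPoly; ring
    have h3 : n ^ 2 / 2 * (3 * d) ≤
        (n ^ 2 - (d - 1) * n - q * d ^ 2) * ((q + 1) * d + 1) := by
      apply mul_le_mul h1 _ (by positivity) (le_trans (by positivity) h1)
      nlinarith
    have h4 : (n - (q + 1) * d) * d * n ≤ n * d * n := by
      gcongr
      nlinarith
    have h5 : 0 ≤ n ^ 2 * d := by positivity
    rw [h2]
    nlinarith
  obtain ⟨r, hr, hr0⟩ := intermediate_value_Icc (by nlinarith : n - q * d - 1 ≤ n)
    hcont.continuousOn ⟨hlo.le, hhi⟩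
  refine ⟨r, lt_of_le_of_ne hr.1 ?_, hr0⟩
  rintro rfl
  exact hlo.ne hr0

/-- The polynomials for `s` and `d` differ by `q * (s - d)` times a factor which the size of `n`
makes positive at `r`. -/
theorem quotientPoly_pos {q n d s r : ℝ} (hq : 2 ≤ q) (hd : 1 ≤ d)
    (hn : 3 * (q + 1) * d + 2 ≤ n) (hs : d < s) (hsn : (q + 1) * s ≤ n)
    (hr : n - q * d - 1 < r) (hr0 : quotientPoly q n d r = 0) : 0 < quotientPoly q n s r := by
  have hdiff : quotientPoly q n s r = quotientPoly q n d r + q * (s - d) *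
      (r ^ 2 - (s + d - 1) * r + (s + d) * (n - 1) - (q + 1) * (s ^ 2 + s * d + d ^ 2)) := by
    unfold quotientPoly; ring
  rw [hdiff, hr0, zero_add]
  refine mul_pos (mul_pos (by linarith) (by linarith)) ?_
  -- The factor equals `(r + 1)(r - s - d) + (n - (q + 1)s)(s + d) - (q + 1)d²`; the first term is
  -- at least `2n(n - 1)/9`, the last is at most `(n - 2)²/27`.
  have h1 : (q + 1) * s * (s + d) ≤ n * (s + d) :=
    mul_le_mul_of_nonneg_right hsn (by linarith)
  have hqd : (q + 1) * d ≤ (n - 2) / 3 := by linarith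
  have h3s : 3 * s ≤ n := by nlinarith
  have h9d : 9 * d ≤ n - 2 := by nlinarith
  have h2 : 2 * n / 3 ≤ r + 1 := by nlinarith
  have h3 : n / 3 - 1 / 3 ≤ r - s - d := by nlinarith
  have h4 : 2 * n / 3 * (n / 3 - 1 / 3) ≤ (r + 1) * (r - s - d) := by
    apply mul_le_mul h2 h3 <;> linarith
  have h5 : (q + 1) * d * d ≤ (n - 2) / 3 * ((n - 2) / 9) := by
    apply mul_le_mul hqd <;> linarith
  nlinarith

theorem nonempty_iso_splitGraph {V : Type*} [Fintype V] {S I : Finset V} {a b c : ℕ}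
    (hSI : Disjoint S I) (hS : S.card = a) (hI : I.card = c) (hV : Fintype.card V = a + (b + c)) :
    Nonempty (splitGraph S I ≃g joinCompleteUnion a b c) := by
  classical
  have hK : (S ∪ I)ᶜ.card = b := by
    rw [Finset.card_compl, Finset.card_union_of_disjoint hSI]
    lia
  let eS := (S.equivFinOfCardEq hS).symm
  let eI := (I.equivFinOfCardEq hI).symm
  let eK := ((S ∪ I)ᶜ.equivFinOfCardEq hK).symm
  let f : Fin a ⊕ (Fin b ⊕ Fin c) → V :=
    Sum.elim (fun i => eS i) (Sum.elim (fun i => eK i) (fun i => eI i))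
  have hmS : ∀ i, (eS i : V) ∈ S := fun i => (eS i).2
  have hmS' : ∀ i, (eS i : V) ∉ I := fun i => Finset.disjoint_left.1 hSI (hmS i)
  have hmI : ∀ i, (eI i : V) ∈ I := fun i => (eI i).2
  have hmI' : ∀ i, (eI i : V) ∉ S := fun i => Finset.disjoint_right.1 hSI (hmI i)
  have hmK : ∀ i, (eK i : V) ∉ S ∧ (eK i : V) ∉ I := fun i => by
    simpa using (eK i).2
  have hinj : Function.Injective f := by
    rintro (i | i | i) (j | j | j) hij <;>
      simp only [f, Sum.elim_inl, Sum.elim_inr] at hij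
    · exact congrArg _ (eS.injective (Subtype.ext hij))
    · exact absurd (hij ▸ hmS i) (hmK j).1
    · exact absurd (hij ▸ hmS i) (hmI' j)
    · exact absurd (hij ▸ hmS j) (hmK i).1
    · exact congrArg (Sum.inr ∘ Sum.inl) (eK.injective (Subtype.ext hij))
    · exact absurd (hij ▸ hmI j) (hmK i).2
    · exact absurd (hij ▸ hmS j) (hmI' i)
    · exact absurd (hij ▸ hmI i) (hmK j).2
    · exact congrArg (Sum.inr ∘ Sum.inr) (eI.injective (Subtype.ext hij))
  have hbij : Function.Bijective f :=
    (Fintype.bijective_iff_injective_and_card f).2 ⟨hinj, by simp [hV]⟩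
  refine ⟨RelIso.symm ⟨Equiv.ofBijective f hbij, ?_⟩⟩
  intro x y
  rw [Equiv.ofBijective_apply, Equiv.ofBijective_apply]
  change (f x ≠ f y ∧ _) ↔ _
  rw [hinj.ne_iff]
  rcases x with i | i | i <;> rcases y with j | j | j <;>
    simp [f, joinCompleteUnion, join, hmS, hmI, hmI', hmK]

end Spectral
end LeafDegreeSpectral

/-! ### The main theorem -/

theorem theorem1p14 {V : Type*} [Fintype V] (G : SimpleGraph V) [DecidableRel G.Adj]
    (n δ k : ℕ) (hk : 1 ≤ k) (hconn : G.Connected) (hn : Fintype.card V = n)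
    (hδ : G.minDegree = δ) (hnδ : 3 * (k + 2) * δ + 2 ≤ n)
    (hρ : LeafDegreeSpectral.spectralRadius
        (LeafDegreeSpectral.joinCompleteUnion δ (n - k * δ - 2 * δ) (k * δ + δ)) ≤
      LeafDegreeSpectral.spectralRadius G) :
    (∃ T : SimpleGraph V, LeafDegreeSpectral.IsSpanningTree T G ∧
        LeafDegreeSpectral.leafDegree T ≤ k) ↔
      ¬ Nonempty
        (G ≃g LeafDegreeSpectral.joinCompleteUnion δ (n - k * δ - 2 * δ) (k * δ + δ)) := by
  classical
  have hnt : Nontrivial V := Fintype.one_lt_card_iff_nontrivial.1 (by lia)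
  have hδ1 : 1 ≤ δ := by
    obtain ⟨v, hv⟩ := G.exists_minimal_degree_vertex
    rw [← hδ, hv]
    exact (G.degree_pos_iff_exists_adj v).2 (hconn.preconnected.exists_adj_of_nontrivial v)
  have hprod : 3 * (k + 2) * δ = 3 * (k * δ) + 6 * δ := by ring
  have hkδ : δ ≤ k * δ := Nat.le_mul_of_pos_left δ hk
  constructor
  · rintro ⟨T, hT, hTk⟩ ⟨e⟩
    -- Deleting the `δ` joined vertices isolates exactly `(k + 1) * δ` vertices, violating the
    -- strict bound.
    have hlt := hT.isolatedBound hTk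
      (Finset.univ.map (Function.Embedding.inl.trans e.symm.toEquiv.toEmbedding))
      (Finset.univ.map ((Function.Embedding.inr.trans Function.Embedding.inr).trans
        e.symm.toEquiv.toEmbedding)) (by
          rw [Finset.map_nonempty]
          exact ⟨⟨0, hδ1⟩, Finset.mem_univ _⟩) (by
          intro v hv
          simp only [Finset.mem_map, Finset.mem_univ, true_and] at hv ⊢
          obtain ⟨i, rfl⟩ := hv
          refine ⟨?_, fun w hw => ?_⟩
          · rintro ⟨j, hj⟩
            have := e.symm.injective hj
            simp at this
          · have h1 := e.map_adj_iff.2 hw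
            change (LeafDegreeSpectral.joinCompleteUnion _ _ _).Adj
              (e (e.symm (Sum.inr (Sum.inr i)))) (e w) at h1
            rw [RelIso.apply_symm_apply] at h1
            rcases hew : e w with j | j | j
            · refine ⟨j, ?_⟩
              change e.symm (Sum.inl j) = w
              rw [← hew, RelIso.symm_apply_apply]
            · rw [hew] at h1
              simp [LeafDegreeSpectral.joinCompleteUnion, LeafDegreeSpectral.join] at h1
            · rw [hew] at h1
              simp [LeafDegreeSpectral.joinCompleteUnion, LeafDegreeSpectral.join] at h1)
    rw [Finset.card_map, Finset.card_map, Finset.card_univ, Finset.card_univ, Fintype.card_fin,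
      Fintype.card_fin, add_mul, one_mul] at hlt
    exact lt_irrefl _ hlt
  · intro hiso
    by_contra hno
    have hbound : ¬ LeafDegreeSpectral.IsolatedBound G (k + 1) := fun h =>
      hno (h.exists_spanningTree hk hconn (by lia))
    unfold LeafDegreeSpectral.IsolatedBound at hbound
    push Not at hbound
    obtain ⟨S, I₀, hS, hI₀, hcard₀⟩ := hbound
    -- Trimming to exactly `(k + 1) * #S` isolated vertices leaves one parameter, `#S`.
    obtain ⟨I, hII₀, hcard⟩ := Finset.exists_subset_card_eq hcard₀
    have hI : ∀ v ∈ I, v ∉ S ∧ ∀ w, G.Adj v w → w ∈ S := fun v hv => hI₀ v (hII₀ hv)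
    have hSI : Disjoint S I := Finset.disjoint_right.2 fun v hv => (hI v hv).1
    have hle := LeafDegreeSpectral.le_splitGraph fun v hv => (hI v hv).2
    -- A vertex of `I` has all its neighbours, at least `δ` of them, in `S`.
    have hδS : δ ≤ S.card := by
      obtain ⟨v, hv⟩ : I.Nonempty := by
        rw [← Finset.card_pos, hcard]
        exact Nat.mul_pos (by lia) (Finset.card_pos.2 hS)
      rw [← hδ]
      refine (G.minDegree_le_degree v).trans (Finset.card_le_card fun w hw => ?_)
      exact (hI v hv).2 w ((G.mem_neighborFinset v w).1 hw)
    have hSn : (k + 2) * S.card ≤ n := by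
      have h1 := Finset.card_le_univ (S ∪ I)
      rw [Finset.card_union_of_disjoint hSI, hcard, hn] at h1
      calc (k + 2) * S.card = S.card + (k + 1) * S.card := by ring
        _ ≤ n := h1
    set q : ℝ := ((k + 1 : ℕ) : ℝ) with hq
    have hq2 : 2 ≤ q := by rw [hq]; exact_mod_cast (by lia : 2 ≤ k + 1)
    have hd : (1 : ℝ) ≤ δ := by exact_mod_cast hδ1
    have hqn : 3 * (q + 1) * δ + 2 ≤ (n : ℝ) := by
      rw [hq]
      exact_mod_cast hnδ
    have hqS : (q + 1) * S.card ≤ (n : ℝ) := by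
      rw [hq]
      exact_mod_cast hSn
    have hδS' : (δ : ℝ) ≤ S.card := by exact_mod_cast hδS
    obtain ⟨r, hr, hr0⟩ := LeafDegreeSpectral.exists_quotientPoly_root hq2 hd hqn
    have hrpos : 0 < r := by nlinarith
    obtain ⟨b, hb⟩ : ∃ b, n = b + (k + 2) * δ :=
      ⟨n - (k + 2) * δ, by have : 3 * (k + 2) * δ = 3 * ((k + 2) * δ) := by ring
                           lia⟩
    have hb' : n - k * δ - 2 * δ = b := by
      rw [hb, add_mul]
      lia
    have hbr : (n : ℝ) = b + (q + 1) * δ := by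
      rw [hb, hq]
      push_cast
      ring
    rw [hb'] at hρ hiso
    have hmem : r ∈ LeafDegreeSpectral.adjEigenvalues
        (LeafDegreeSpectral.joinCompleteUnion δ b (k * δ + δ)) := by
      refine LeafDegreeSpectral.mem_adjEigenvalues_joinCompleteUnion (q := q) hδ1 hrpos ?_ ?_ ?_
      · rw [hq]; push_cast; ring
      · rw [hbr] at hr
        linarith
      · rw [← hbr]; exact hr0
    have : Nonempty (Fin δ ⊕ (Fin b ⊕ Fin (k * δ + δ))) := ⟨Sum.inl ⟨0, hδ1⟩⟩
    have hrle := (LeafDegreeSpectral.spectralRadius_isGreatest _).2 hmem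
    have hGmem := (LeafDegreeSpectral.spectralRadius_isGreatest G).1
    have hpos : δ < S.card → 0 < LeafDegreeSpectral.quotientPoly q n S.card r := fun h =>
      LeafDegreeSpectral.quotientPoly_pos hq2 hd hqn (by exact_mod_cast h) hqS hr hr0
    have hmain := LeafDegreeSpectral.eq_splitGraph_of_le hconn hS hSI hcard hle hrpos
      (by rw [hn]; nlinarith) (by
        rw [hn]
        rcases hδS.lt_or_eq with h | h
        · exact (hpos h).le
        · rw [← h]; exact hr0.ge) hGmem (hrle.trans hρ)
    rw [hn] at hmain
    have hSδ : S.card = δ := by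
      by_contra h
      exact (hpos (lt_of_le_of_ne hδS (Ne.symm h))).ne' hmain.1
    apply hiso
    rw [hmain.2]
    refine LeafDegreeSpectral.nonempty_iso_splitGraph hSI hSδ (by rw [hcard, hSδ]; ring) ?_
    rw [hn, hb]
    ring
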